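/- All posets and lattices are finite. Write $x\prec y$ if $y$ covers $x$. An element of a lattice is reducible if it is the meet of two elements both different from it (meet-reducible) or the join of two elements both different from it (join-reducible). The nullity of a poset is $e-v+c$, where $e$, $v$, $c$ are the numbers of edges, vertices and connected components of its cover graph. A block is a finite lattice whose least element $0$ is meet-reducible and whose largest element $1$ is join-reducible. For a poset $P$, let $\mathrm{Irr}(P)$ be the set of elements with at most one lower and at most one upper cover, $\mathrm{Irr}^*(P)$ the set of elements with exactly one lower and exactly one upper cover, and $\mathrm{Red}(P)=P\setminus\mathrm{Irr}(P)$. An element $x\in\mathrm{Irr}(P)$ is retractible if either there are no $y,z\in\mathrm{Red}(P)$ with $y\prec x\prec z$, or there are $y,z\in\mathrm{Red}(P)$ with $y\prec x\prec z$ such that $y\prec x\prec z$ is the only directed path from $y$ to $z$ along coverings. A basic retract associated to $P$ is a subposet obtained from $P$ by successively removing retractible elements of $\mathrm{Irr}^*$ until no element of $\mathrm{Irr}^*$ is retractible; the basic block associated to $P$ is obtained from it by successively removing all pendant vertices (vertices of degree one of the cover graph), and is considered up to isomorphism. Let $B_3$ be the lattice on the seven elements $0,a,b,1,c_1,c_2,c_3$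 whose coverings are exactly $0\prec a\prec b\prec 1$, $0\prec c_1\prec b$, $a\prec c_2\prec 1$ and $0\prec c_3\prec 1$. For an integer $j\ge 7$, let $\mathbb{B}_3(j;4,3)$ be the class of all non-isomorphic blocks on $j$ elements that have exactly four reducible elements, these being pairwise comparable, that have nullity three, and whose associated basic block is $B_3$. Then $$|\mathbb{B}_3(j;4,3)|=\sum_{p=1}^{j-6}\binom{j-p-2}{4}.$$ -/

import Mathlib

namespace RCLattice

section Poset

/-- `Irr(P)`: at most one lower cover and at most one upper cover. -/
def posetIrr (P : Type*) [PartialOrder P] : Set P :=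
  {x | {y | y ⋖ x}.Subsingleton ∧ {y | x ⋖ y}.Subsingleton}

/-- `Irr*(P)`: exactly one lower cover and exactly one upper cover. -/
def posetIrrStar (P : Type*) [PartialOrder P] : Set P :=
  {x | (∃! y, y ⋖ x) ∧ (∃! y, x ⋖ y)}

/-- `Red(P)`, the complement of `Irr(P)`. -/
def posetRed (P : Type*) [PartialOrder P] : Set P := (posetIrr P)ᶜ

/-- `l` is a directed path from `y` to `z` in the cover graph (every step goes up a covering). -/
def IsDirectedPath {P : Type*} [PartialOrder P] (y z : P) (l : List P) : Prop :=
  l.IsChain (· ⋖ ·) ∧ l.head? = some y ∧ l.getLast? = some z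

/-- `x` is a retractible element of the poset `P`. -/
def IsRetractible {P : Type*} [PartialOrder P] (x : P) : Prop :=
  x ∈ posetIrr P ∧
    ((¬ ∃ y ∈ posetRed P, ∃ z ∈ posetRed P, y ⋖ x ∧ x ⋖ z) ∨
      ∃ y ∈ posetRed P, ∃ z ∈ posetRed P, y ⋖ x ∧ x ⋖ z ∧
        ∀ l : List P, IsDirectedPath y z l → l = [y, x, z])

/-- `P` is a basic retract: no element of `Irr*(P)` is retractible in `P`. -/
def IsBasicRetract (P : Type*) [PartialOrder P] : Prop :=
  ∀ x ∈ posetIrrStar P, ¬ IsRetractible x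

/-- `x` is a pendant vertex of `P`: it has exactly one neighbour in the cover graph. -/
def IsPendant {P : Type*} [PartialOrder P] (x : P) : Prop :=
  ((SimpleGraph.hasse P).neighborSet x).ncard = 1

/-- The subposet `T` arises from the subposet `S` by removing one element of `Irr*(S)` that is
retractible in `S`. -/
def RetractStep {P : Type*} [PartialOrder P] (S T : Set P) : Prop :=
  ∃ x : S, x ∈ posetIrrStar S ∧ IsRetractible x ∧ T = S \ {(x : P)}

/-- The subposet `T` arises from the subposet `S` by removing one pendant vertex of `S`. -/
def PendantStep {P : Type*} [PartialOrder P] (S T : Set P) : Prop :=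
  ∃ x : S, IsPendant x ∧ T = S \ {(x : P)}

/-- The subposet `R` of `P` is a basic retract associated to `P`: it is a basic retract obtained
from `P` by successive removal of retractible elements of `Irr*`. -/
def IsBasicRetractOf {P : Type*} [PartialOrder P] (R : Set P) : Prop :=
  Relation.ReflTransGen RetractStep Set.univ R ∧ IsBasicRetract R

/-- The subposet `B` of `P` is a basic block associated to `P`: it is obtained from a basic
retract associated to `P` by successive removal of all the pendant vertices. -/
def IsBasicBlockOf {P : Type*} [PartialOrder P] (B : Set P) : Prop :=
  ∃ R : Set P, IsBasicRetractOf R ∧ Relation.ReflTransGen PendantStep R B ∧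
    ∀ x : B, ¬ IsPendant x

/-- The poset `Q` is (up to isomorphism) the basic block associated to the poset `P`. -/
def HasBasicBlock (P Q : Type*) [PartialOrder P] [PartialOrder Q] : Prop :=
  ∃ B : Set P, IsBasicBlockOf B ∧ Nonempty (B ≃o Q)

/-- The nullity of a finite poset: (number of edges) - (number of vertices) + (number of connected
components) of its cover graph. -/
noncomputable def nullity (P : Type*) [PartialOrder P] : ℤ :=
  ((SimpleGraph.hasse P).edgeSet.ncard : ℤ) - (Nat.card P : ℤ)
    + (Nat.card (SimpleGraph.hasse P).ConnectedComponent : ℤ)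

end Poset

section Lattices

def IsMeetReducible {L : Type*} [Lattice L] (a : L) : Prop :=
  ∃ b c : L, b ≠ a ∧ c ≠ a ∧ b ⊓ c = a

def IsJoinReducible {L : Type*} [Lattice L] (a : L) : Prop :=
  ∃ b c : L, b ≠ a ∧ c ≠ a ∧ b ⊔ c = a

/-- The set of reducible elements of a lattice. -/
def reducibles (L : Type*) [Lattice L] : Set L :=
  {a | IsMeetReducible a ∨ IsJoinReducible a}

/-- A finite lattice with meet-reducible least element and join-reducible largest element. -/
def IsBlock (L : Type*) [Lattice L] : Prop :=
  Finite L ∧ (∃ o : L, IsBot o ∧ IsMeetReducible o) ∧ (∃ i : L, IsTop i ∧ IsJoinReducible i)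

end Lattices

/-- Lattices with exactly `j` elements. -/
structure LatticeOn (j : ℕ) where
  carrier : Type
  [lattice : Lattice carrier]
  [finite : Finite carrier]
  card_eq : Nat.card carrier = j

attribute [instance] LatticeOn.lattice LatticeOn.finite

/-- Isomorphism of lattices on `j` elements. -/
instance LatticeOn.isoSetoid (j : ℕ) : Setoid (LatticeOn j) where
  r L M := Nonempty (L.carrier ≃o M.carrier)
  iseqv :=
    { refl := fun L => ⟨OrderIso.refl L.carrier⟩
      symm := fun ⟨e⟩ => ⟨e.symm⟩
      trans := fun ⟨e⟩ ⟨f⟩ => ⟨e.trans f⟩ }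

/-- The number of pairwise non-isomorphic lattices on `j` elements in the class `C`. -/
noncomputable def numNonisomorphic {j : ℕ} (C : Set (LatticeOn j)) : ℕ :=
  ((Quotient.mk (LatticeOn.isoSetoid j)) '' C).ncard

/-- The class `𝓑(j; r, k)` of blocks on `j` elements with exactly `r` reducible elements, these
being pairwise comparable, and with nullity `k`. -/
def blockClass (j r k : ℕ) : Set (LatticeOn j) :=
  {L | IsBlock L.carrier ∧ (reducibles L.carrier).ncard = r ∧
    (∀ x ∈ reducibles L.carrier, ∀ y ∈ reducibles L.carrier, x ≤ y ∨ y ≤ x) ∧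
    nullity L.carrier = (k : ℤ)}

/-- The underlying set of the basic block `B₃`. -/
inductive B3 : Type
  | zero
  | a
  | b
  | one
  | c1
  | c2
  | c3

namespace B3

/-- The coverings of `B₃`: the chain `0 ≺ a ≺ b ≺ 1` together with `0 ≺ c₁ ≺ b`, `a ≺ c₂ ≺ 1`
and `0 ≺ c₃ ≺ 1`. -/
inductive Edge : B3 → B3 → Prop
  | zero_a : Edge zero a
  | a_b : Edge a b
  | b_one : Edge b one
  | zero_c1 : Edge zero c1
  | c1_b : Edge c1 b
  | a_c2 : Edge a c2
  | c2_one : Edge c2 one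
  | zero_c3 : Edge zero c3
  | c3_one : Edge c3 one

/-- The order of `B₃`, listed explicitly. -/
inductive Le : B3 → B3 → Prop
  | rfl (x : B3) : Le x x
  | bot (x : B3) : Le zero x
  | top (x : B3) : Le x one
  | a_b : Le a b
  | a_c2 : Le a c2
  | c1_b : Le c1 b

instance : PartialOrder B3 where
  le := Le
  le_refl := Le.rfl
  le_trans x y z h₁ h₂ := by cases h₁ <;> cases h₂ <;> constructor
  le_antisymm x y h₁ h₂ := by cases h₁ <;> cases h₂ <;> rfl

/-- The covering relation of the order on `B₃` is the intended diagram. -/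
theorem covBy_iff_edge (x y : B3) : x ⋖ y ↔ Edge x y := by
  have hlt : ∀ u v : B3, u < v ↔ Le u v ∧ u ≠ v := fun u v => lt_iff_le_and_ne
  constructor
  · rintro ⟨h, hn⟩
    rw [hlt] at h
    obtain ⟨h, hne⟩ := h
    have key : ∀ u : B3, Le x u → x ≠ u → Le u y → u ≠ y → False := fun u h₁ h₂ h₃ h₄ =>
      hn ((hlt _ _).2 ⟨h₁, h₂⟩) ((hlt _ _).2 ⟨h₃, h₄⟩)
    have ka := key a
    have kb := key b
    have kc := key c3
    cases h with
    | rfl => exact absurd rfl hne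
    | bot => cases y <;> first
        | exact absurd rfl hne
        | constructor
        | exact (ka (by constructor) (by simp) (by constructor) (by simp)).elim
    | top => cases x <;> first
        | exact absurd rfl hne
        | constructor
        | exact (kb (by constructor) (by simp) (by constructor) (by simp)).elim
    | a_b => constructor
    | a_c2 => constructor
    | c1_b => constructor
  · intro h
    refine ⟨(hlt _ _).2 ?_, fun u h₁ h₂ => ?_⟩
    · cases h <;> exact ⟨by constructor, by simp⟩
    · rw [hlt] at h₁ h₂
      obtain ⟨p₁, q₁⟩ := h₁
      obtain ⟨p₂, q₂⟩ := h₂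
      cases h <;> cases p₁ <;> cases p₂ <;> simp_all

end B3

/-- The class `𝔹₃(j; 4, 3)` of the members of `𝓑(j; 4, 3)` whose associated basic block
is `B₃`. -/
def blockClassB3 (j : ℕ) : Set (LatticeOn j) :=
  {L | L ∈ blockClass j 4 3 ∧ HasBasicBlock L.carrier B3}

end RCLattice

/-! The blocks in question are the subdivisions of `B₃`. They are cut into chains indexed by the
eight labels: `0`, `1`, and six chains of free length, which are `]0, a]`, `]a, b[`, `[b, 1[` and
the replacements of `c₁`, `c₂`, `c₃`. Only `]a, b[` may be empty, because `a ≺ b` is a bare edge of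
`B₃`. Comparison of elements in different chains depends on the labels alone. Such a decomposition
is a layout (`IsLayout`).

A block in the class has a layout. An element of `Irr*` is retractible exactly when it is the only
element strictly between its two neighbours (`retractible_iff`), so undoing a removal inserts an
element into a covering pair, and this lengthens one chain (`exists_of_diff`). Two atoms and two
coatoms survive every removal, so no pendant vertex ever appears and the basic retract is already
the basic block.

Conversely, a surplus element of a chain can always be removed, so a block with a layout retracts to
`B₃` (`hasBasicBlock`). A layout also forces a lattice, in fact a block, with reducible elements `0
< a < b < 1` and nullity three. Hence the class consists of the lattices with a layout
(`mem_blockClassB3_iff`).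

The layout is unique (`IsLayout.unique`): apart from `0` and `1`, only `a` has no least strict upper
bound, `b` is dual to it, and the position of an element relative to `0, a, b, 1` gives its label.
So the six chain lengths are a complete isomorphism invariant. After the seven elements of `B₃` are
taken away, they distribute `j - 7` surplus elements over six chains. There are `(j - 2).choose 5`
ways, which is the stated sum by the hockey-stick identity. -/

namespace RCLattice

/-! ### Labels and layouts -/

/-- The indices of the chains into which a subdivision of `B₃` decomposes: `low` is the half-open
interval `]0, a]`, `mid` is `]a, b[`, `high` is `[b, 1[`, and `left`, `right`, `outer` are the
chains that replace `c₁`, `c₂`, `c₃`. -/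
inductive Label : Type
  | zero
  | low
  | mid
  | high
  | one
  | left
  | right
  | outer

namespace Label

instance : DecidableEq Label := fun l m =>
  decidable_of_iff (l.ctorIdx = m.ctorIdx)
    ⟨fun h => by (cases l <;> cases m <;> first | rfl | cases h), congrArg _⟩

instance : Fintype Label where
  elems := {zero, low, mid, high, one, left, right, outer}
  complete l := by cases l <;> decide

/-- The order of the chains, as a Boolean table. -/
def leb : Label → Label → Bool
  | zero, _ => true
  | _, one => true
  | low, low => true
  | low, mid => true
  | low, high => true
  | low, right => true
  | mid, mid => true
  | mid, high => true
  | high, high => true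
  | left, left => true
  | left, high => true
  | right, right => true
  | outer, outer => true
  | _, _ => false

instance : PartialOrder Label where
  le x y := leb x y = true
  le_refl := by decide
  le_trans := by decide
  le_antisymm := by decide

instance : DecidableLE Label := fun x y => inferInstanceAs (Decidable (leb x y = true))

instance : DecidableLT Label := decidableLTOfDecidableLE

/-- The order-reversing involution of the labels. -/
def flip : Label → Label
  | zero => one
  | low => high
  | mid => mid
  | high => low
  | one => zero
  | left => right
  | right => left
  | outer => outer

theorem flip_flip : ∀ l : Label, flip (flip l) = l := by decide

theorem flip_inj {l m : Label} : flip l = flip m ↔ l = m := by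
  revert l m; decide

theorem flip_le_flip {l m : Label} : flip l ≤ flip m ↔ m ≤ l := by
  revert l m; decide

theorem flip_lt_flip {l m : Label} : flip l < flip m ↔ m < l := by
  revert l m; decide

end Label

theorem exists_greatest_of_total {P : Type*} [PartialOrder P] [Finite P] {S : Set P} {p : P → Prop}
    (hp : ∃ x ∈ S, p x) (htot : ∀ x ∈ S, ∀ y ∈ S, p x → p y → x ≤ y ∨ y ≤ x) :
    ∃ x ∈ S, p x ∧ ∀ y ∈ S, p y → y ≤ x := by
  obtain ⟨x, hx⟩ := (Set.toFinite {x | x ∈ S ∧ p x}).exists_maximal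
    (by obtain ⟨x, hx, hpx⟩ := hp; exact ⟨x, hx, hpx⟩)
  refine ⟨x, hx.1.1, hx.1.2, fun y hy hpy => ?_⟩
  rcases htot x hx.1.1 y hy hx.1.2 hpy with hxy | hxy
  · exact hx.2 ⟨hy, hpy⟩ hxy
  · exact hxy

theorem exists_least_of_total {P : Type*} [PartialOrder P] [Finite P] {S : Set P} {p : P → Prop}
    (hp : ∃ x ∈ S, p x) (htot : ∀ x ∈ S, ∀ y ∈ S, p x → p y → x ≤ y ∨ y ≤ x) :
    ∃ x ∈ S, p x ∧ ∀ y ∈ S, p y → x ≤ y :=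
  exists_greatest_of_total (P := Pᵒᵈ) (S := OrderDual.ofDual ⁻¹' S) hp
    fun x hx y hy hpx hpy => (htot x hx y hy hpx hpy).symm

/-- `f` presents the subposet `S` as the lexicographic sum of chains indexed by the labels, where
all chains but the one at `mid` are nonempty, and those at `zero` and `one` are singletons. -/
structure IsLayout {P : Type*} [PartialOrder P] (S : Set P) (f : P → Label) : Prop where
  lt_of_lt : ∀ x ∈ S, ∀ y ∈ S, f x < f y → x < y
  map_le : ∀ x ∈ S, ∀ y ∈ S, x ≤ y → f x ≤ f y
  total : ∀ x ∈ S, ∀ y ∈ S, f x = f y → x ≤ y ∨ y ≤ x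
  zero_unique : ∀ x ∈ S, ∀ y ∈ S, f x = .zero → f y = .zero → x = y
  one_unique : ∀ x ∈ S, ∀ y ∈ S, f x = .one → f y = .one → x = y
  exists_eq : ∀ l : Label, l ≠ .mid → ∃ x ∈ S, f x = l

namespace IsLayout

variable {P : Type*} [PartialOrder P] {S : Set P} {f : P → Label}

/-- `B₃` is self-dual: `flip` exchanges `low` with `high` and `left` with `right`. Every statement
about lower covers therefore yields the one about upper covers. -/
theorem dual (h : IsLayout S f) :
    IsLayout (OrderDual.ofDual ⁻¹' S) (fun x : Pᵒᵈ => (f (OrderDual.ofDual x)).flip) where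
  lt_of_lt x hx y hy hxy := h.lt_of_lt _ hy _ hx (Label.flip_lt_flip.1 hxy)
  map_le x hx y hy hxy := Label.flip_le_flip.2 (h.map_le _ hy _ hx hxy)
  total x hx y hy hxy := h.total _ hy _ hx (Label.flip_inj.1 hxy).symm
  zero_unique x hx y hy hfx hfy :=
    h.one_unique _ hx _ hy ((Label.flip_flip _).symm.trans (congrArg Label.flip hfx))
      ((Label.flip_flip _).symm.trans (congrArg Label.flip hfy))
  one_unique x hx y hy hfx hfy :=
    h.zero_unique _ hx _ hy ((Label.flip_flip _).symm.trans (congrArg Label.flip hfx))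
      ((Label.flip_flip _).symm.trans (congrArg Label.flip hfy))
  exists_eq l hl := by
    obtain ⟨x, hx, hfx⟩ := h.exists_eq l.flip (by revert l; decide)
    exact ⟨OrderDual.toDual x, hx, by simp [hfx, Label.flip_flip]⟩

theorem exists_fiber_max [Finite P] (h : IsLayout S f) {l : Label} (hl : ∃ x ∈ S, f x = l) :
    ∃ x ∈ S, f x = l ∧ ∀ y ∈ S, f y = l → y ≤ x :=
  exists_greatest_of_total hl fun x hx y hy hfx hfy => h.total x hx y hy (hfx.trans hfy.symm)

theorem exists_fiber_min [Finite P] (h : IsLayout S f) {l : Label} (hl : ∃ x ∈ S, f x = l) :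
    ∃ x ∈ S, f x = l ∧ ∀ y ∈ S, f y = l → x ≤ y :=
  exists_least_of_total hl fun x hx y hy hfx hfy => h.total x hx y hy (hfx.trans hfy.symm)

theorem zero_le (h : IsLayout S f) {o x : P} (ho : o ∈ S) (hfo : f o = .zero) (hx : x ∈ S) :
    o ≤ x := by
  by_cases hfx : f x = .zero
  · exact (h.zero_unique o ho x hx hfo hfx).le
  · refine (h.lt_of_lt o ho x hx ?_).le
    rw [hfo]; revert hfx; generalize f x = l; revert l; decide

theorem le_one (h : IsLayout S f) {i x : P} (hi : i ∈ S) (hfi : f i = .one) (hx : x ∈ S) :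
    x ≤ i := by
  by_cases hfx : f x = .one
  · exact (h.one_unique x hx i hi hfx hfi).le
  · refine (h.lt_of_lt x hx i hi ?_).le
    rw [hfi]; revert hfx; generalize f x = l; revert l; decide

end IsLayout
end RCLattice

/-! ### Retractible elements in terms of the order -/

namespace RCLattice

section Retract

variable {P : Type*} [PartialOrder P]

/-- In the subposet `S`, the element `x` lies on the covering path `y ≺ x ≺ z`, has no other
lower or upper cover, and is the only element strictly between `y` and `z`. -/
structure IsSmoothable (S : Set P) (y x z : P) : Prop where
  mem_left : y ∈ S
  mem : x ∈ S
  mem_right : z ∈ S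
  left_lt : y < x
  lt_right : x < z
  le_left : ∀ w ∈ S, w < x → w ≤ y
  right_le : ∀ w ∈ S, x < w → z ≤ w
  eq_of_between : ∀ w ∈ S, y < w → w < z → w = x

theorem IsSmoothable.dual {S : Set P} {y x z : P} (h : IsSmoothable S y x z) :
    IsSmoothable (P := Pᵒᵈ) (OrderDual.ofDual ⁻¹' S) (OrderDual.toDual z) (OrderDual.toDual x)
      (OrderDual.toDual y) :=
  ⟨h.mem_right, h.mem, h.mem_left, h.lt_right, h.left_lt, h.right_le, h.le_left,
    fun w hw h₁ h₂ => h.eq_of_between w hw h₂ h₁⟩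

theorem existsUnique_covBy_iff [Finite P] {x : P} :
    (∃! y, y ⋖ x) ↔ ∃ y, y < x ∧ ∀ w, w < x → w ≤ y := by
  constructor
  · rintro ⟨y, hy, huniq⟩
    refine ⟨y, hy.lt, fun w hw => ?_⟩
    obtain ⟨u, hwu, hu⟩ := exists_le_covBy_of_lt hw
    exact hwu.trans (huniq u hu).le
  · rintro ⟨y, hy, hle⟩
    refine ⟨y, ⟨hy, fun w h₁ h₂ => (hle w h₂).not_gt h₁⟩, fun w hw => ?_⟩
    exact (hle w hw.lt).eq_of_not_lt fun hwy => hw.2 hwy hy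

theorem existsUnique_covBy_iff' [Finite P] {x : P} :
    (∃! y, x ⋖ y) ↔ ∃ y, x < y ∧ ∀ w, x < w → y ≤ w := by
  have h := existsUnique_covBy_iff (P := Pᵒᵈ) (x := OrderDual.toDual x)
  simp only [← toDual_covBy_toDual_iff (α := P)] at *
  exact h

theorem exists_isChain_cons_covBy [Finite P] {y z : P} (h : y ≤ z) :
    ∃ l, (y :: l).IsChain (· ⋖ ·) ∧ (y :: l).getLast? = some z := by
  have : Fintype P := Fintype.ofFinite P
  classical
  have : LocallyFiniteOrder P := Fintype.toLocallyFiniteOrder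
  obtain ⟨l, hl, hlast⟩ :=
    List.exists_isChain_cons_of_relationReflTransGen (le_iff_reflTransGen_covBy.1 h)
  exact ⟨l, hl, by rw [List.getLast?_eq_getLast_of_ne_nil (by simp), hlast]⟩

/-- Any further element between `y` and `z` lies on some covering path, so uniqueness of the path
forbids it. -/
theorem exists_directedPath_mem [Finite P] {y w z : P} (h₁ : y < w) (h₂ : w ≤ z) :
    ∃ l : List P, IsDirectedPath y z l ∧ w ∈ l := by
  obtain ⟨u, hyu, huw⟩ := exists_le_covBy_of_lt h₁
  obtain ⟨l₁, hl₁, hlast₁⟩ := exists_isChain_cons_covBy hyu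
  obtain ⟨l₂, hl₂, hlast₂⟩ := exists_isChain_cons_covBy h₂
  refine ⟨(y :: l₁) ++ (w :: l₂), ⟨?_, rfl, ?_⟩, by simp⟩
  · refine List.isChain_append.2 ⟨hl₁, hl₂, ?_⟩
    simp only [hlast₁, Option.mem_def, List.head?_cons, Option.some.injEq]
    rintro _ rfl _ rfl
    exact huw
  · rw [List.getLast?_append_of_ne_nil _ (by simp), hlast₂]

theorem le_of_isChain_covBy {l : List P} : ∀ {y z : P}, (y :: l).IsChain (· ⋖ ·) →
    (y :: l).getLast? = some z → y ≤ z := by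
  induction l with
  | nil => intro y z _ h; simp at h; exact h.le
  | cons a l ih =>
    intro y z hl h
    rw [List.isChain_cons_cons] at hl
    rw [List.getLast?_cons_cons] at h
    exact hl.1.le.trans (ih hl.2 h)

theorem isDirectedPath_eq {y x z : P} (hyx : y < x) (hxz : x < z)
    (h : ∀ w, y < w → w < z → w = x) {l : List P} (hl : IsDirectedPath y z l) :
    l = [y, x, z] := by
  obtain ⟨hl, hhead, hlast⟩ := hl
  match l, hl, hhead, hlast with
  | [a], _, hhead, hlast =>
    simp at hhead hlast
    exact absurd (hyx.trans hxz) (by simp [← hhead, ← hlast])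
  | a :: u :: l, hl, hhead, hlast =>
    obtain rfl : a = y := by simpa using hhead
    rw [List.isChain_cons_cons] at hl
    rw [List.getLast?_cons_cons] at hlast
    have huz : u < z := (le_of_isChain_covBy hl.2 hlast).lt_of_ne
      (by rintro rfl; exact hl.1.2 hyx hxz)
    obtain rfl := h u hl.1.lt huz
    match l, hl.2, hlast with
    | [], _, hlast => simp at hlast; exact absurd hxz (by simp [hlast])
    | v :: l, hl', hlast =>
      rw [List.isChain_cons_cons] at hl'
      rw [List.getLast?_cons_cons] at hlast
      obtain rfl : v = z := by
        by_contra hne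
        exact hl'.1.lt.ne' (h v (hyx.trans hl'.1.lt)
          ((le_of_isChain_covBy hl'.2 hlast).lt_of_ne hne))
      match l, hl'.2, hlast with
      | [], _, _ => rfl
      | w :: l, hl'', hlast =>
        rw [List.isChain_cons_cons] at hl''
        rw [List.getLast?_cons_cons] at hlast
        exact absurd hl''.1.lt (le_of_isChain_covBy hl''.2 hlast).not_gt

/-- Let `y ≺ x ≺ z` be the unique covers. If `y` and `z` are both reducible, uniqueness of the path
says that nothing else lies between them. If, say, `z` is irreducible, then `x` is its only lower
cover, so an element strictly between `y` and `z` is at most `x`, and it equals `x` since everything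
below `x` is at most `y`. Thus both clauses of the definition reduce to one condition. -/
theorem retractible_iff [Finite P] {x : P} :
    (x ∈ posetIrrStar P ∧ IsRetractible x) ↔ ∃ y z, IsSmoothable Set.univ y x z := by
  constructor
  · rintro ⟨⟨hlow, hup⟩, -, hret⟩
    obtain ⟨y, hyx, hy⟩ := existsUnique_covBy_iff.1 hlow
    obtain ⟨z, hxz, hz⟩ := existsUnique_covBy_iff'.1 hup
    have hcy : y ⋖ x := ⟨hyx, fun w h₁ h₂ => (hy w h₂).not_gt h₁⟩
    have hcz : x ⋖ z := ⟨hxz, fun w h₁ h₂ => (hz w h₁).not_gt h₂⟩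
    refine ⟨y, z, trivial, trivial, trivial, hyx, hxz, fun w _ => hy w, fun w _ => hz w,
      fun w _ h₁ h₂ => ?_⟩
    rcases hret with hret | ⟨y', -, z', -, hy', hz', hpath⟩
    · push Not at hret
      by_cases hyr : y ∈ posetRed P
      · have hzr : z ∈ posetIrr P := by
          by_contra hzr
          exact hret y hyr z hzr hcy hcz
        obtain ⟨u, hwu, hu⟩ := exists_le_covBy_of_lt h₂
        have hux : u = x := hzr.1 hu hcz
        exact (hwu.trans hux.le).eq_of_not_lt fun hwx => (hy w hwx).not_gt h₁
      · obtain ⟨u, hu, huw⟩ := exists_covBy_le_of_lt h₁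
        have hux : u = x := (not_not.1 hyr).2 hu hcy
        exact ((hux.symm.le.trans huw).eq_of_not_lt fun hxw => (hz w hxw).not_gt h₂).symm
    · obtain rfl := hlow.unique hcy hy'
      obtain rfl := hup.unique hcz hz'
      obtain ⟨l, hl, hwl⟩ := exists_directedPath_mem h₁ h₂.le
      rw [hpath l hl] at hwl
      simp only [List.mem_cons, List.not_mem_nil, or_false] at hwl
      rcases hwl with rfl | rfl | rfl
      · exact absurd h₁ (lt_irrefl _)
      · rfl
      · exact absurd h₂ (lt_irrefl _)
  · rintro ⟨y, z, h⟩
    have hcy : y ⋖ x := ⟨h.left_lt, fun w h₁ h₂ => (h.le_left w trivial h₂).not_gt h₁⟩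
    have hcz : x ⋖ z := ⟨h.lt_right, fun w h₁ h₂ => (h.right_le w trivial h₁).not_gt h₂⟩
    have hlow : ∃! y, y ⋖ x :=
      existsUnique_covBy_iff.2 ⟨y, h.left_lt, fun w => h.le_left w trivial⟩
    have hup : ∃! z, x ⋖ z :=
      existsUnique_covBy_iff'.2 ⟨z, h.lt_right, fun w => h.right_le w trivial⟩
    refine ⟨⟨hlow, hup⟩, ⟨fun u hu v hv => hlow.unique hu hv, fun u hu v hv => hup.unique hu hv⟩, ?_⟩
    by_cases hred : ∃ y ∈ posetRed P, ∃ z ∈ posetRed P, y ⋖ x ∧ x ⋖ z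
    · obtain ⟨y', hy'r, z', hz'r, hy', hz'⟩ := hred
      obtain rfl := hlow.unique hcy hy'
      obtain rfl := hup.unique hcz hz'
      exact Or.inr ⟨y, hy'r, z, hz'r, hy', hz', fun l hl =>
        isDirectedPath_eq h.left_lt h.lt_right (fun w => h.eq_of_between w trivial) hl⟩
    · exact Or.inl hred

/-- This moves the condition from the subtype to the ambient order, where successive removals can be
compared. -/
theorem isSmoothable_coe {S : Set P} {y x z : S} :
    IsSmoothable Set.univ y x z ↔ IsSmoothable S (y : P) x z :=
  ⟨fun h => ⟨y.2, x.2, z.2, h.left_lt, h.lt_right, fun w hw => h.le_left ⟨w, hw⟩ trivial,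
      fun w hw => h.right_le ⟨w, hw⟩ trivial,
      fun w hw h₁ h₂ => congrArg Subtype.val (h.eq_of_between ⟨w, hw⟩ trivial h₁ h₂)⟩,
    fun h => ⟨trivial, trivial, trivial, h.left_lt, h.lt_right, fun w _ => h.le_left w w.2,
      fun w _ => h.right_le w w.2, fun w _ h₁ h₂ => Subtype.ext (h.eq_of_between w w.2 h₁ h₂)⟩⟩

theorem retractStep_iff [Finite P] {S T : Set P} :
    RetractStep S T ↔ ∃ y x z, IsSmoothable S y x z ∧ T = S \ {x} := by
  constructor
  · rintro ⟨x, hx, hret, rfl⟩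
    obtain ⟨y, z, h⟩ := retractible_iff.1 ⟨hx, hret⟩
    exact ⟨y, x, z, isSmoothable_coe.1 h, rfl⟩
  · rintro ⟨y, x, z, h, rfl⟩
    obtain ⟨hx, hret⟩ := retractible_iff.2 ⟨⟨y, h.mem_left⟩, ⟨z, h.mem_right⟩,
      (isSmoothable_coe (x := ⟨x, h.mem⟩)).2 h⟩
    exact ⟨⟨x, h.mem⟩, hx, hret, rfl⟩

theorem isBasicRetract_iff [Finite P] {S : Set P} :
    IsBasicRetract S ↔ ∀ y x z, ¬ IsSmoothable S y x z := by
  constructor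
  · intro hS y x z h
    obtain ⟨hx, hret⟩ := retractible_iff.2 ⟨⟨y, h.mem_left⟩, ⟨z, h.mem_right⟩,
      (isSmoothable_coe (x := ⟨x, h.mem⟩)).2 h⟩
    exact hS _ hx hret
  · intro hS x hx hret
    obtain ⟨y, z, h⟩ := retractible_iff.1 ⟨hx, hret⟩
    exact hS _ _ _ (isSmoothable_coe.1 h)

end Retract
end RCLattice

/-! ### Absence of pendant vertices -/

namespace RCLattice

section Pendant

variable {P : Type*} [PartialOrder P]

/-- The subposet `S` has a least element, which has two distinct upper covers in `S`. -/
def HasTwoAtoms (S : Set P) : Prop :=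
  ∃ o ∈ S, (∀ w ∈ S, o ≤ w) ∧ ∃ u ∈ S, ∃ v ∈ S, u ≠ v ∧ o < u ∧ o < v ∧
    (∀ w ∈ S, o < w → w ≤ u → w = u) ∧ (∀ w ∈ S, o < w → w ≤ v → w = v)

/-- The subposet `S` has a largest element, which has two distinct lower covers in `S`. -/
def HasTwoCoatoms (S : Set P) : Prop :=
  HasTwoAtoms (P := Pᵒᵈ) (OrderDual.ofDual ⁻¹' S)

/-- If the removed `x` is one of the two atoms, then `y` is the least element and `z` becomes an
atom in place of `x`. It differs from the other atom `v`, since `x` is not below `v`. -/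
theorem IsSmoothable.hasTwoAtoms_diff {S : Set P} {y x z : P} (h : IsSmoothable S y x z)
    (hS : HasTwoAtoms S) : HasTwoAtoms (S \ {x}) := by
  obtain ⟨o, ho, hbot, u, hu, v, hv, huv, hou, hov, hu', hv'⟩ := hS
  have key : ∀ v ∈ S, x ≠ v → o < x → o < v → (∀ w ∈ S, o < w → w ≤ x → w = x) →
      (∀ w ∈ S, o < w → w ≤ v → w = v) → HasTwoAtoms (S \ {x}) := by
    intro v hv hxv hox hov hx' hv'
    have hyo : y = o := by
      by_contra hne
      exact h.left_lt.ne (hx' y h.mem_left ((hbot y h.mem_left).lt_of_ne' hne) h.left_lt.le)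
    subst hyo
    refine ⟨y, ⟨ho, h.left_lt.ne⟩, fun w hw => hbot w hw.1, z, ⟨h.mem_right, h.lt_right.ne'⟩, v,
      ⟨hv, hxv.symm⟩, ?_, h.left_lt.trans h.lt_right, hov, fun w hw h₁ h₂ => ?_,
      fun w hw => hv' w hw.1⟩
    · rintro rfl
      exact hxv (hv' x h.mem h.left_lt h.lt_right.le)
    · exact h₂.eq_of_not_lt fun h₃ => hw.2 (h.eq_of_between w hw.1 h₁ h₃)
  by_cases hxu : x = u
  · subst hxu; exact key v hv huv hou hov hu' hv'
  by_cases hxv : x = v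
  · subst hxv; exact key u hu huv.symm hov hou hv' hu'
  have hxo : o ≠ x := fun hox => (hox ▸ h.left_lt).not_ge (hbot y h.mem_left)
  exact ⟨o, ⟨ho, hxo⟩, fun w hw => hbot w hw.1, u, ⟨hu, Ne.symm hxu⟩, v, ⟨hv, Ne.symm hxv⟩, huv,
    hou, hov, fun w hw => hu' w hw.1, fun w hw => hv' w hw.1⟩

theorem IsSmoothable.hasTwoCoatoms_diff {S : Set P} {y x z : P} (h : IsSmoothable S y x z)
    (hS : HasTwoCoatoms S) : HasTwoCoatoms (S \ {x}) :=
  h.dual.hasTwoAtoms_diff hS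

theorem not_isPendant_of_ne {x u v : P} (huv : u ≠ v) (hu : x ⋖ u ∨ u ⋖ x)
    (hv : x ⋖ v ∨ v ⋖ x) : ¬ IsPendant x := by
  intro h
  obtain ⟨w, hw⟩ := Set.ncard_eq_one.1 h
  have hu' : u ∈ (SimpleGraph.hasse P).neighborSet x := hu
  have hv' : v ∈ (SimpleGraph.hasse P).neighborSet x := hv
  rw [hw] at hu' hv'
  exact huv (hu'.trans hv'.symm)

/-- The least and the largest element have two neighbours by assumption; any other element has a
lower and an upper cover. -/
theorem not_isPendant [Finite P] {S : Set P} (h₁ : HasTwoAtoms S) (h₂ : HasTwoCoatoms S) (x : S) :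
    ¬ IsPendant x := by
  obtain ⟨o, ho, hbot, u, hu, v, hv, huv, hou, hov, hu', hv'⟩ := h₁
  obtain ⟨i, hi, htop, u₂, hu₂, v₂, hv₂, huv₂, hiu, hiv, hu₂', hv₂'⟩ := h₂
  by_cases hxo : (x : P) = o
  · refine not_isPendant_of_ne (u := ⟨u, hu⟩) (v := ⟨v, hv⟩) (fun h => huv (congrArg Subtype.val h))
      (Or.inl ⟨?_, fun w hw₁ hw₂ => ?_⟩) (Or.inl ⟨?_, fun w hw₁ hw₂ => ?_⟩)
    · exact show (x : P) < u from hxo ▸ hou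
    · exact hw₂.ne (Subtype.ext (hu' w w.2 (hxo ▸ hw₁) hw₂.le))
    · exact show (x : P) < v from hxo ▸ hov
    · exact hw₂.ne (Subtype.ext (hv' w w.2 (hxo ▸ hw₁) hw₂.le))
  by_cases hxi : (x : P) = i
  · have hiu' : OrderDual.ofDual u₂ < (x : P) := by rw [hxi]; exact hiu
    have hiv' : OrderDual.ofDual v₂ < (x : P) := by rw [hxi]; exact hiv
    refine not_isPendant_of_ne (u := ⟨OrderDual.ofDual u₂, hu₂⟩) (v := ⟨OrderDual.ofDual v₂, hv₂⟩)
      (fun h => huv₂ (congrArg Subtype.val h))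
      (Or.inr ⟨hiu', fun w hw₁ hw₂ => ?_⟩) (Or.inr ⟨hiv', fun w hw₁ hw₂ => ?_⟩)
    · have hw₂' : (w : P) < i := by rw [← hxi]; exact hw₂
      exact hw₁.ne' (Subtype.ext (hu₂' (OrderDual.toDual (w : P)) w.2 hw₂' hw₁.le))
    · have hw₂' : (w : P) < i := by rw [← hxi]; exact hw₂
      exact hw₁.ne' (Subtype.ext (hv₂' (OrderDual.toDual (w : P)) w.2 hw₂' hw₁.le))
  · have hox : (⟨o, ho⟩ : S) < x := (hbot x x.2).lt_of_ne' hxo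
    have hxi' : x < (⟨i, hi⟩ : S) := lt_of_le_of_ne (α := P) (htop (OrderDual.toDual (x : P)) x.2) hxi
    obtain ⟨p, -, hp⟩ := exists_le_covBy_of_lt hox
    obtain ⟨q, hq, -⟩ := exists_covBy_le_of_lt hxi'
    exact not_isPendant_of_ne (hp.lt.trans hq.lt).ne (Or.inr hp) (Or.inl hq)

theorem eq_of_reflTransGen_pendantStep [Finite P] {S T : Set P} (h₁ : HasTwoAtoms S)
    (h₂ : HasTwoCoatoms S) (h : Relation.ReflTransGen PendantStep S T) : S = T := by
  rcases h.cases_head with h | ⟨U, ⟨x, hx, -⟩, -⟩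
  · exact h
  · exact absurd hx (not_isPendant h₁ h₂ x)

theorem hasTwoAtoms_univ_of_isMeetReducible {L : Type*} [Lattice L] [Finite L] {o : L}
    (ho : IsBot o) (h : IsMeetReducible o) : HasTwoAtoms (Set.univ : Set L) := by
  obtain ⟨b, c, hb, hc, hbc⟩ := h
  obtain ⟨u, hu, hub⟩ := exists_covBy_le_of_lt ((ho b).lt_of_ne' hb)
  obtain ⟨v, hv, hvc⟩ := exists_covBy_le_of_lt ((ho c).lt_of_ne' hc)
  refine ⟨o, trivial, fun w _ => ho w, u, trivial, v, trivial, ?_, hu.lt, hv.lt,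
    fun w _ h₁ h₂ => h₂.eq_of_not_lt fun h₃ => hu.2 h₁ h₃,
    fun w _ h₁ h₂ => h₂.eq_of_not_lt fun h₃ => hv.2 h₁ h₃⟩
  rintro rfl
  exact hu.lt.not_ge ((le_inf hub hvc).trans hbc.le)

theorem hasTwoCoatoms_univ_of_isJoinReducible {L : Type*} [Lattice L] [Finite L] {i : L}
    (hi : IsTop i) (h : IsJoinReducible i) : HasTwoCoatoms (Set.univ : Set L) :=
  hasTwoAtoms_univ_of_isMeetReducible (L := Lᵒᵈ) (o := OrderDual.toDual i) hi h

theorem hasTwoAtoms_of_reflTransGen [Finite P] {S T : Set P} (hS : HasTwoAtoms S)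
    (h : Relation.ReflTransGen RetractStep S T) : HasTwoAtoms T := by
  induction h with
  | refl => exact hS
  | tail _ hstep ih =>
    obtain ⟨y, x, z, h, rfl⟩ := retractStep_iff.1 hstep
    exact h.hasTwoAtoms_diff ih

theorem hasTwoCoatoms_of_reflTransGen [Finite P] {S T : Set P} (hS : HasTwoCoatoms S)
    (h : Relation.ReflTransGen RetractStep S T) : HasTwoCoatoms T := by
  induction h with
  | refl => exact hS
  | tail _ hstep ih =>
    obtain ⟨y, x, z, h, rfl⟩ := retractStep_iff.1 hstep
    exact h.hasTwoCoatoms_diff ih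

end Pendant

/-! ### From the basic block to a layout: inserting elements -/

namespace Label

/-- The chain to which an element inserted between a covering pair with the given labels belongs. -/
def between : Label → Label → Label
  | zero, low => low
  | zero, left => left
  | zero, outer => outer
  | low, mid => mid
  | low, high => mid
  | low, right => right
  | mid, high => mid
  | left, high => left
  | high, one => high
  | right, one => right
  | outer, one => outer
  | l, _ => l

/-- The first alternative excludes a covering pair, since every chain except `mid` is inhabited; it
holds for all pairs `l < m` that reach the default line of `between`. In the second, the inserted
label lies immediately next to each end label from which it differs. -/
theorem between_spec : ∀ l m : Label, l < m →
    (∃ k, k ≠ mid ∧ l < k ∧ k < m) ∨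
    (between l m ≠ zero ∧ between l m ≠ one ∧ l ≤ between l m ∧ between l m ≤ m ∧
      (between l m ≠ m → ∀ k, between l m < k → m ≤ k) ∧
      (between l m ≠ l → ∀ k, k < between l m → k ≤ l)) := by decide

end Label

namespace IsLayout

variable {P : Type*} [PartialOrder P] {S : Set P} {f : P → Label}

open Classical in
/-- A layout extends back along the removal of a smoothable element. -/
theorem exists_of_diff {y x z : P} (hs : IsSmoothable S y x z) (h : IsLayout (S \ {x}) f) :
    ∃ g, IsLayout S (Function.update f x g) := by
  have hy : y ∈ S \ {x} := ⟨hs.mem_left, hs.left_lt.ne⟩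
  have hz : z ∈ S \ {x} := ⟨hs.mem_right, hs.lt_right.ne'⟩
  have hyz : y < z := hs.left_lt.trans hs.lt_right
  have hbet : ∀ w ∈ S \ {x}, y < w → w < z → False :=
    fun w hw h₁ h₂ => hw.2 (hs.eq_of_between w hw.1 h₁ h₂)
  -- The label `g` of `x` is the common one if `y` and `z` share a chain, and is read from the table
  -- otherwise. The singleton chains are excluded because `y ≠ z`.
  obtain ⟨g, hg0, hg1, hyg, hgz, hup, hdown⟩ : ∃ g, g ≠ .zero ∧ g ≠ .one ∧ f y ≤ g ∧ g ≤ f z ∧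
      (g ≠ f z → ∀ k, g < k → f z ≤ k) ∧ (g ≠ f y → ∀ k, k < g → k ≤ f y) := by
    rcases (h.map_le y hy z hz hyz.le).lt_or_eq with hlt | heq
    · rcases Label.between_spec _ _ hlt with ⟨k, hk, h₁, h₂⟩ | hb
      · obtain ⟨w, hw, rfl⟩ := h.exists_eq k hk
        exact (hbet w hw (h.lt_of_lt y hy w hw h₁) (h.lt_of_lt w hw z hz h₂)).elim
      · exact ⟨_, hb⟩
    · refine ⟨f y, fun h0 => ?_, fun h1 => ?_, le_rfl, heq.le, fun hne => (hne heq).elim,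
        fun hne => (hne rfl).elim⟩
      · exact hyz.ne (h.zero_unique y hy z hz h0 (heq ▸ h0))
      · exact hyz.ne (h.one_unique y hy z hz h1 (heq ▸ h1))
  have hmem : ∀ w ∈ S, w ≠ x → w ∈ S \ {x} := fun w hw hwx => ⟨hw, hwx⟩
  have habove : ∀ w ∈ S \ {x}, (x < w ↔ z ≤ w) :=
    fun w hw => ⟨hs.right_le w hw.1, hs.lt_right.trans_le⟩
  have hbelow : ∀ w ∈ S \ {x}, (w < x ↔ w ≤ y) :=
    fun w hw => ⟨hs.le_left w hw.1, fun hwy => hwy.trans_lt hs.left_lt⟩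
  -- Comparison with `x` amounts to comparison with `z` from above and with `y` from below. The next
  -- three facts thus make `x` fit into the chain at `g`; each rests on `y` and `z` having nothing
  -- between them once `x` is gone.
  have hgt : ∀ w ∈ S \ {x}, g < f w → z ≤ w := by
    intro w hw hgw
    by_cases hgz' : g = f z
    · exact (h.lt_of_lt z hz w hw (hgz' ▸ hgw)).le
    · rcases (hup hgz' _ hgw).lt_or_eq with hlt | heq
      · exact (h.lt_of_lt z hz w hw hlt).le
      · rcases h.total z hz w hw heq with hzw | hwz
        · exact hzw
        · exact (hwz.eq_of_not_lt
            fun hlt => hbet w hw (h.lt_of_lt y hy w hw (hyg.trans_lt hgw)) hlt).ge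
  have hlt : ∀ w ∈ S \ {x}, f w < g → w ≤ y := by
    intro w hw hgw
    by_cases hgy' : g = f y
    · exact (h.lt_of_lt w hw y hy (hgy' ▸ hgw)).le
    · rcases (hdown hgy' _ hgw).lt_or_eq with hlt | heq
      · exact (h.lt_of_lt w hw y hy hlt).le
      · rcases h.total w hw y hy heq with hzw | hwz
        · exact hzw
        · exact (hwz.eq_of_not_lt
            fun hlt => hbet w hw hlt (h.lt_of_lt w hw z hz (hgw.trans_le hgz))).ge
  have htot : ∀ w ∈ S \ {x}, f w = g → w ≤ y ∨ z ≤ w := by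
    intro w hw hwg
    rcases hyg.lt_or_eq with h₁ | h₁
    · rcases hgz.lt_or_eq with h₂ | h₂
      · exact (hbet w hw (h.lt_of_lt y hy w hw (hwg ▸ h₁))
          (h.lt_of_lt w hw z hz (hwg ▸ h₂))).elim
      · rcases h.total z hz w hw (h₂.symm.trans hwg.symm) with h₃ | h₃
        · exact Or.inr h₃
        · exact Or.inr (h₃.eq_of_not_lt
            fun hlt => hbet w hw (h.lt_of_lt y hy w hw (hwg ▸ h₁)) hlt).ge
    · rcases h.total w hw y hy (hwg.trans h₁.symm) with h₃ | h₃
      · exact Or.inl h₃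
      · by_cases hwy : w = y
        · exact Or.inl hwy.le
        · have hyw : y < w := h₃.lt_of_ne' hwy
          by_cases hwz : w < z
          · exact (hbet w hw hyw hwz).elim
          · rcases hgz.lt_or_eq with h₂ | h₂
            · exact (hwz (h.lt_of_lt w hw z hz (hwg ▸ h₂))).elim
            · rcases h.total z hz w hw (h₂.symm.trans hwg.symm) with h₄ | h₄
              · exact Or.inr h₄
              · exact Or.inr (h₄.eq_of_not_lt hwz).ge
  have hfx : Function.update f x g x = g := Function.update_self ..
  have hfw : ∀ w, w ≠ x → Function.update f x g w = f w :=
    fun w hw => Function.update_of_ne hw ..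
  refine ⟨g, ⟨?_, ?_, ?_, ?_, ?_, ?_⟩⟩
  · intro u hu v hv huv
    by_cases hux : u = x <;> by_cases hvx : v = x
    · subst hux; subst hvx; exact (lt_irrefl _ huv).elim
    · subst hux
      rw [hfx, hfw v hvx] at huv
      exact (habove v ⟨hv, hvx⟩).2 (hgt v ⟨hv, hvx⟩ huv)
    · subst hvx
      rw [hfx, hfw u hux] at huv
      exact (hbelow u ⟨hu, hux⟩).2 (hlt u ⟨hu, hux⟩ huv)
    · rw [hfw u hux, hfw v hvx] at huv
      exact h.lt_of_lt u ⟨hu, hux⟩ v ⟨hv, hvx⟩ huv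
  · intro u hu v hv huv
    by_cases hux : u = x <;> by_cases hvx : v = x
    · subst hux; subst hvx; exact le_rfl
    · subst hux
      rw [hfx, hfw v hvx]
      exact hgz.trans (h.map_le z hz v ⟨hv, hvx⟩
        (hs.right_le v hv (huv.lt_of_ne (Ne.symm hvx))))
    · subst hvx
      rw [hfx, hfw u hux]
      exact (h.map_le u ⟨hu, hux⟩ y hy (hs.le_left u hu (huv.lt_of_ne hux))).trans hyg
    · rw [hfw u hux, hfw v hvx]
      exact h.map_le u ⟨hu, hux⟩ v ⟨hv, hvx⟩ huv
  · intro u hu v hv huv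
    by_cases hux : u = x <;> by_cases hvx : v = x
    · subst hux; subst hvx; exact Or.inl le_rfl
    · subst hux
      rw [hfx, hfw v hvx] at huv
      exact (htot v ⟨hv, hvx⟩ huv.symm).elim (fun h => Or.inr (h.trans hs.left_lt.le))
        fun h => Or.inl (hs.lt_right.le.trans h)
    · subst hvx
      rw [hfx, hfw u hux] at huv
      exact (htot u ⟨hu, hux⟩ huv).elim (fun h => Or.inl (h.trans hs.left_lt.le))
        fun h => Or.inr (hs.lt_right.le.trans h)
    · rw [hfw u hux, hfw v hvx] at huv
      exact h.total u ⟨hu, hux⟩ v ⟨hv, hvx⟩ huv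
  · intro u hu v hv hu0 hv0
    have hux : u ≠ x := by rintro rfl; exact hg0 (hfx ▸ hu0)
    have hvx : v ≠ x := by rintro rfl; exact hg0 (hfx ▸ hv0)
    rw [hfw _ hux] at hu0
    rw [hfw _ hvx] at hv0
    exact h.zero_unique u ⟨hu, hux⟩ v ⟨hv, hvx⟩ hu0 hv0
  · intro u hu v hv hu0 hv0
    have hux : u ≠ x := by rintro rfl; exact hg1 (hfx ▸ hu0)
    have hvx : v ≠ x := by rintro rfl; exact hg1 (hfx ▸ hv0)
    rw [hfw _ hux] at hu0
    rw [hfw _ hvx] at hv0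
    exact h.one_unique u ⟨hu, hux⟩ v ⟨hv, hvx⟩ hu0 hv0
  · intro l hl
    obtain ⟨w, hw, hwl⟩ := h.exists_eq l hl
    exact ⟨w, hw.1, by rw [hfw w hw.2, hwl]⟩

theorem exists_of_reflTransGen [Finite P] {T : Set P}
    (h : Relation.ReflTransGen RetractStep S T) (hT : ∃ f, IsLayout T f) : ∃ f, IsLayout S f := by
  induction h using Relation.ReflTransGen.head_induction_on with
  | refl => exact hT
  | head hstep _ ih =>
    obtain ⟨y, x, z, h, rfl⟩ := retractStep_iff.1 hstep
    obtain ⟨f, hf⟩ := ih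
    exact ⟨_, (exists_of_diff h hf).choose_spec⟩

end IsLayout

/-- The label of an element of `B₃`. -/
def B3.label : B3 → Label
  | zero => .zero
  | a => .low
  | b => .high
  | one => .one
  | c1 => .left
  | c2 => .right
  | c3 => .outer

theorem B3.label_injective : Function.Injective B3.label := by
  intro x y h; cases x <;> cases y <;> first | rfl | cases h

theorem B3.label_le_label {x y : B3} : x.label ≤ y.label ↔ x ≤ y := by
  constructor
  · intro h
    cases x <;> cases y <;> first
      | exact absurd h (by decide)
      | (change B3.Le _ _; constructor)
  · intro h
    cases (show B3.Le x y from h) <;> first | exact le_rfl | decide | (cases x <;> decide) | (cases y <;> decide)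

theorem exists_isLayout_of_orderIso {P : Type*} [PartialOrder P] {S : Set P} (e : S ≃o B3) :
    ∃ f, IsLayout S f := by
  classical
  have hle : ∀ x y : S, (e x).label ≤ (e y).label ↔ (x : P) ≤ y :=
    fun x y => B3.label_le_label.trans e.le_iff_le
  have hlt : ∀ x y : S, (e x).label < (e y).label ↔ (x : P) < y := fun x y => by
    rw [lt_iff_le_not_ge, hle, hle, ← lt_iff_le_not_ge]
  have heq : ∀ x y : S, (e x).label = (e y).label → (x : P) = y :=
    fun x y h => congrArg Subtype.val (e.injective (B3.label_injective h))
  -- The value off `S` is arbitrary, since a layout constrains only the elements of `S`.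
  refine ⟨fun x => if hx : x ∈ S then (e ⟨x, hx⟩).label else .zero, ⟨?_, ?_, ?_, ?_, ?_, ?_⟩⟩
  · intro x hx y hy; simp only [hx, hy, dif_pos]; exact (hlt _ _).1
  · intro x hx y hy; simp only [hx, hy, dif_pos]; exact (hle ⟨x, hx⟩ ⟨y, hy⟩).2
  · intro x hx y hy; simp only [hx, hy, dif_pos]; exact fun h => Or.inl (heq _ _ h).le
  · intro x hx y hy; simp only [hx, hy, dif_pos]; exact fun h h' => heq _ _ (h.trans h'.symm)
  · intro x hx y hy; simp only [hx, hy, dif_pos]; exact fun h h' => heq _ _ (h.trans h'.symm)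
  · intro l hl
    obtain ⟨x, hx⟩ : ∃ x : B3, x.label = l := by
      cases l
      exacts [⟨.zero, rfl⟩, ⟨.a, rfl⟩, (hl rfl).elim, ⟨.b, rfl⟩, ⟨.one, rfl⟩, ⟨.c1, rfl⟩,
        ⟨.c2, rfl⟩, ⟨.c3, rfl⟩]
    exact ⟨e.symm x, (e.symm x).2, by simp [hx]⟩

/-- A block whose basic block is `B₃` has a layout. -/
theorem exists_isLayout_of_hasBasicBlock {L : Type*} [Lattice L] (hL : IsBlock L)
    (h : HasBasicBlock L B3) : ∃ f, IsLayout (Set.univ : Set L) f := by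
  obtain ⟨hfin, ⟨o, ho, hor⟩, ⟨i, hi, hir⟩⟩ := hL
  obtain ⟨B, ⟨R, ⟨hR, -⟩, hB, -⟩, ⟨e⟩⟩ := h
  have h₁ := hasTwoAtoms_of_reflTransGen (hasTwoAtoms_univ_of_isMeetReducible ho hor) hR
  have h₂ := hasTwoCoatoms_of_reflTransGen (hasTwoCoatoms_univ_of_isJoinReducible hi hir) hR
  obtain rfl := eq_of_reflTransGen_pendantStep h₁ h₂ hB
  exact IsLayout.exists_of_reflTransGen hR (exists_isLayout_of_orderIso e)

end RCLattice

/-! ### From a layout back to the basic block: removing elements -/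

namespace RCLattice

namespace Label

/-- The unique lower cover of a label other than `zero`, `high` and `one`. -/
def pred : Label → Label
  | mid => low
  | right => low
  | _ => zero

/-- The unique upper cover of a label other than `zero`, `low` and `one`. -/
def succ : Label → Label
  | mid => high
  | left => high
  | _ => one

/-- Only the chain at `mid` may be empty, so the chain at `l.pred` has a largest element. -/
theorem pred_ne_mid : ∀ l : Label, l.pred ≠ mid := by decide

theorem pred_lt : ∀ l : Label, l ≠ zero → l.pred < l := by decide

theorem le_pred_of_lt : ∀ l : Label, l ≠ high → l ≠ one → ∀ k, k < l → k ≤ l.pred := by decide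

theorem flip_pred_flip : ∀ l : Label, l ≠ zero → l.flip.pred.flip = l.succ := by decide

end Label

namespace IsLayout

variable {P : Type*} [PartialOrder P] {S : Set P} {f : P → Label}

theorem exists_greatest_lt_of_fiber [Finite P] (h : IsLayout S f) {x : P} (hx : x ∈ S)
    (hfib : ∃ w ∈ S, f w = f x ∧ w < x) :
    ∃ y ∈ S, f y = f x ∧ y < x ∧ ∀ w ∈ S, w < x → w ≤ y := by
  obtain ⟨y, hy, ⟨hyx, hlt⟩, hmax⟩ := exists_greatest_of_total (p := fun w => f w = f x ∧ w < x)
    hfib fun u hu v hv h₁ h₂ => h.total u hu v hv (h₁.1.trans h₂.1.symm)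
  refine ⟨y, hy, hyx, hlt, fun w hw hwx => ?_⟩
  rcases (h.map_le w hw x hx hwx.le).lt_or_eq with hl | he
  · exact (h.lt_of_lt w hw y hy (hyx ▸ hl)).le
  · exact hmax w hw ⟨he, hwx⟩

/-- At the bottom of its chain, `x` sits directly on the top of the chain at the preceding label.
The label `high` is excluded because it covers both `mid` and `left`. -/
theorem exists_greatest_lt_of_not_fiber [Finite P] (h : IsLayout S f) {x : P} (hx : x ∈ S)
    (hfib : ¬ ∃ w ∈ S, f w = f x ∧ w < x) (h0 : f x ≠ .zero) (hh : f x ≠ .high)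
    (h1 : f x ≠ .one) : ∃ y ∈ S, f y = (f x).pred ∧ y < x ∧ ∀ w ∈ S, w < x → w ≤ y := by
  obtain ⟨y, hy, hyx, hmax⟩ := h.exists_fiber_max (h.exists_eq _ (Label.pred_ne_mid (f x)))
  refine ⟨y, hy, hyx, h.lt_of_lt y hy x hx (hyx ▸ Label.pred_lt _ h0), fun w hw hwx => ?_⟩
  rcases (h.map_le w hw x hx hwx.le).lt_or_eq with hl | he
  · rcases (Label.le_pred_of_lt _ hh h1 _ hl).lt_or_eq with hl' | he'
    · exact (h.lt_of_lt w hw y hy (hyx ▸ hl')).le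
    · exact hmax w hw he'
  · exact (hfib ⟨w, hw, he, hwx⟩).elim

theorem exists_least_gt_of_fiber [Finite P] (h : IsLayout S f) {x : P} (hx : x ∈ S)
    (hfib : ∃ w ∈ S, f w = f x ∧ x < w) :
    ∃ y ∈ S, f y = f x ∧ x < y ∧ ∀ w ∈ S, x < w → y ≤ w := by
  obtain ⟨y, hy, hyx, h'⟩ := h.dual.exists_greatest_lt_of_fiber (x := OrderDual.toDual x) hx
    (by obtain ⟨w, hw, hwx, hlt⟩ := hfib
        exact ⟨OrderDual.toDual w, hw, congrArg Label.flip hwx, hlt⟩)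
  exact ⟨y, hy, Label.flip_inj.1 hyx, h'⟩

theorem exists_least_gt_of_not_fiber [Finite P] (h : IsLayout S f) {x : P} (hx : x ∈ S)
    (hfib : ¬ ∃ w ∈ S, f w = f x ∧ x < w) (h0 : f x ≠ .zero) (hl : f x ≠ .low)
    (h1 : f x ≠ .one) : ∃ y ∈ S, f y = (f x).succ ∧ x < y ∧ ∀ w ∈ S, x < w → y ≤ w := by
  obtain ⟨y, hy, hyx, h'⟩ := h.dual.exists_greatest_lt_of_not_fiber (x := OrderDual.toDual x) hx
    (by rintro ⟨w, hw, hwx, hlt⟩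
        exact hfib ⟨OrderDual.ofDual w, hw, Label.flip_inj.1 hwx, hlt⟩)
    (fun h => h1 (Label.flip_inj.1 h)) (fun h => hl (Label.flip_inj.1 h))
    (fun h => h0 (Label.flip_inj.1 h))
  refine ⟨y, hy, ?_, h'⟩
  rw [← Label.flip_pred_flip _ h0]
  exact (Label.flip_flip _).symm.trans (congrArg Label.flip hyx)

theorem diff (h : IsLayout S f) {x : P}
    (hx : f x = .mid ∨ ∃ w ∈ S, f w = f x ∧ w ≠ x) : IsLayout (S \ {x}) f where
  lt_of_lt u hu v hv := h.lt_of_lt u hu.1 v hv.1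
  map_le u hu v hv := h.map_le u hu.1 v hv.1
  total u hu v hv := h.total u hu.1 v hv.1
  zero_unique u hu v hv := h.zero_unique u hu.1 v hv.1
  one_unique u hu v hv := h.one_unique u hu.1 v hv.1
  exists_eq l hl := by
    obtain ⟨u, hu, rfl⟩ := h.exists_eq l hl
    by_cases hux : u = x
    · subst hux
      obtain ⟨w, hw, hwu, hne⟩ := hx.resolve_left hl
      exact ⟨w, ⟨hw, hne⟩, hwu⟩
    · exact ⟨u, ⟨hu, hux⟩, rfl⟩

/-- If the chain at a label `l` other than `high` is longer than it is in `B₃`, its least element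
can be removed. -/
theorem exists_isSmoothable [Finite P] (h : IsLayout S f) {l : Label} (hlow : l ≠ .high)
    (hl : (l = .mid ∧ ∃ x ∈ S, f x = l) ∨ ∃ x ∈ S, ∃ w ∈ S, f x = l ∧ f w = l ∧ x ≠ w) :
    ∃ y x z, IsSmoothable S y x z ∧ IsLayout (S \ {x}) f := by
  obtain ⟨x, hx, hxl, hmin⟩ := h.exists_fiber_min (l := l) (by
    obtain ⟨-, x, hx, hxl⟩ | ⟨x, hx, -, -, hxl, -⟩ := hl <;> exact ⟨x, hx, hxl⟩)
  have h0 : l ≠ .zero := by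
    rintro rfl
    obtain ⟨h, -⟩ | ⟨x, hx, w, hw, hxl, hwl, hne⟩ := hl
    · cases h
    · exact hne (h.zero_unique x hx w hw hxl hwl)
  have h1 : l ≠ .one := by
    rintro rfl
    obtain ⟨h, -⟩ | ⟨x, hx, w, hw, hxl, hwl, hne⟩ := hl
    · cases h
    · exact hne (h.one_unique x hx w hw hxl hwl)
  have hnext : l = .mid ∨ ∃ w ∈ S, f w = l ∧ x < w := by
    obtain ⟨h, -⟩ | ⟨u, hu, w, hw, hul, hwl, hne⟩ := hl
    · exact Or.inl h
    · right
      by_cases hux : u = x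
      · exact ⟨w, hw, hwl, (hmin w hw hwl).lt_of_ne (hux ▸ hne)⟩
      · exact ⟨u, hu, hul, (hmin u hu hul).lt_of_ne' hux⟩
  obtain ⟨y, hy, hfy, hyx, hymax⟩ := h.exists_greatest_lt_of_not_fiber hx
    (by rintro ⟨w, hw, hwx, hlt⟩; exact hlt.not_ge (hmin w hw (hwx.trans hxl)))
    (hxl ▸ h0) (hxl ▸ hlow) (hxl ▸ h1)
  -- The element above `x` continues its chain, unless `x` is the whole chain at `mid`; then it
  -- belongs to `high`.
  obtain ⟨z, hz, hfz, hxz, hzmin⟩ : ∃ z ∈ S, (f z = l ∨ (l = .mid ∧ f z = .high)) ∧ x < z ∧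
      ∀ w ∈ S, x < w → z ≤ w := by
    by_cases hfib : ∃ w ∈ S, f w = f x ∧ x < w
    · obtain ⟨z, hz, hfz, h'⟩ := h.exists_least_gt_of_fiber hx hfib
      exact ⟨z, hz, Or.inl (hfz.trans hxl), h'⟩
    · have hmid : l = .mid := hnext.resolve_right (by rwa [hxl] at hfib)
      obtain ⟨z, hz, hfz, h'⟩ := h.exists_least_gt_of_not_fiber hx hfib (hxl ▸ h0)
        (by rw [hxl, hmid]; decide) (hxl ▸ h1)
      exact ⟨z, hz, Or.inr ⟨hmid, by rw [hfz, hxl, hmid]; rfl⟩, h'⟩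
  refine ⟨y, x, z, ⟨hy, hx, hz, hyx, hxz, hymax, hzmin, fun w hw hyw hwz => ?_⟩, ?_⟩
  · have h₁ := h.map_le y hy w hw hyw.le
    have h₂ := h.map_le w hw z hz hwz.le
    have h₃ : f w = l.pred ∨ f w = l ∨ l < f w := by
      rw [hfy, hxl] at h₁
      have key : ∀ l k m : Label, l ≠ .high → l ≠ .one → l.pred ≤ k → k ≤ m →
          (m = l ∨ (l = .mid ∧ m = .high)) → k = l.pred ∨ k = l ∨ l < k := by decide
      exact key l _ _ hlow h1 h₁ h₂ hfz
    rcases h₃ with h₃ | h₃ | h₃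
    · have : w < x := h.lt_of_lt w hw x hx (by rw [h₃, hxl]; exact Label.pred_lt _ h0)
      exact absurd hyw (hymax w hw this).not_gt
    · exact ((hmin w hw h₃).eq_of_not_lt fun hlt => (hzmin w hw hlt).not_gt hwz).symm
    · exact absurd hwz (hzmin w hw (h.lt_of_lt x hx w hw (hxl ▸ h₃))).not_gt
  · refine h.diff (hnext.imp (fun h => hxl.trans h) ?_)
    rintro ⟨w, hw, hwl, hlt⟩
    exact ⟨w, hw, hwl.trans hxl.symm, hlt.ne'⟩

theorem exists_retractStep [Finite P] (h : IsLayout S f)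
    (hS : ¬ (Set.InjOn f S ∧ ∀ x ∈ S, f x ≠ .mid)) :
    ∃ x ∈ S, RetractStep S (S \ {x}) ∧ IsLayout (S \ {x}) f := by
  have key : ∃ l : Label, (l = .mid ∧ ∃ x ∈ S, f x = l) ∨
      ∃ x ∈ S, ∃ w ∈ S, f x = l ∧ f w = l ∧ x ≠ w := by
    by_contra! hcon
    refine hS ⟨fun x hx w hw hxw => ?_, fun x hx hfx => (hcon .mid).1 rfl x hx hfx⟩
    by_contra hne
    exact hne ((hcon (f x)).2 x hx w hw rfl hxw.symm)
  obtain ⟨l, hl⟩ := key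
  -- The least element of the chain at `high` is `b`, which has two lower covers and must stay. The
  -- surplus there is removed from the top, which is the dual of the case `low`.
  by_cases hlow : l = .high
  · subst hlow
    obtain ⟨z, x, y, hs, hlay⟩ := h.dual.exists_isSmoothable (l := .low) (by decide) (by
      obtain ⟨h, -⟩ | ⟨x, hx, w, hw, hxl, hwl, hne⟩ := hl
      · cases h
      · exact Or.inr ⟨OrderDual.toDual x, hx, OrderDual.toDual w, hw,
          congrArg Label.flip hxl, congrArg Label.flip hwl, hne⟩)
    have hs' : IsSmoothable S (OrderDual.ofDual y) (OrderDual.ofDual x) (OrderDual.ofDual z) :=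
      hs.dual
    refine ⟨OrderDual.ofDual x, hs'.mem, retractStep_iff.2 ⟨_, _, _, hs', rfl⟩, ?_⟩
    have hdual : IsLayout (S \ {OrderDual.ofDual x}) fun w => (f w).flip.flip := hlay.dual
    simpa only [Label.flip_flip] using hdual
  · obtain ⟨y, x, z, hs, hlay⟩ := h.exists_isSmoothable hlow hl
    exact ⟨x, hs.mem, retractStep_iff.2 ⟨_, _, _, hs, rfl⟩, hlay⟩

theorem exists_reduced [Finite P] (h : IsLayout S f) :
    ∃ T, Relation.ReflTransGen RetractStep S T ∧ IsLayout T f ∧ Set.InjOn f T ∧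
      ∀ x ∈ T, f x ≠ .mid := by
  induction hn : S.ncard using Nat.strong_induction_on generalizing S with
  | _ n ih =>
    by_cases hS : Set.InjOn f S ∧ ∀ x ∈ S, f x ≠ .mid
    · exact ⟨S, .refl, h, hS⟩
    · obtain ⟨x, hx, hstep, hlay⟩ := h.exists_retractStep hS
      obtain ⟨T, hT, h'⟩ := ih _ (hn ▸ Set.ncard_sdiff_singleton_lt_of_mem hx) hlay rfl
      exact ⟨T, .head hstep hT, h'⟩

theorem le_iff (h : IsLayout S f) (hinj : Set.InjOn f S) {x y : P} (hx : x ∈ S) (hy : y ∈ S) :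
    f x ≤ f y ↔ x ≤ y := by
  refine ⟨fun hxy => ?_, h.map_le x hx y hy⟩
  rcases hxy.lt_or_eq with hl | he
  · exact (h.lt_of_lt x hx y hy hl).le
  · exact (hinj hx hy he).le

theorem nonempty_orderIso_B3 (h : IsLayout S f) (hinj : Set.InjOn f S)
    (hmid : ∀ x ∈ S, f x ≠ .mid) : Nonempty (S ≃o B3) := by
  have hex : ∀ c : B3, ∃ x : S, f x = c.label := fun c => by
    obtain ⟨x, hx, hxc⟩ := h.exists_eq c.label (by cases c <;> decide)
    exact ⟨⟨x, hx⟩, hxc⟩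
  choose g hg using hex
  have hle : ∀ c d, g c ≤ g d ↔ c ≤ d := fun c d => by
    rw [← B3.label_le_label, ← hg, ← hg, h.le_iff hinj (g c).2 (g d).2]; rfl
  have hbij : Function.Bijective g := by
    refine ⟨fun c d hcd => B3.label_injective (by rw [← hg, ← hg, hcd]), fun x => ?_⟩
    obtain ⟨c, hc⟩ : ∃ c : B3, c.label = f x := by
      have := hmid x x.2
      revert this
      generalize f x = l
      intro hl
      cases l
      exacts [⟨.zero, rfl⟩, ⟨.a, rfl⟩, (hl rfl).elim, ⟨.b, rfl⟩, ⟨.one, rfl⟩, ⟨.c1, rfl⟩,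
        ⟨.c2, rfl⟩, ⟨.c3, rfl⟩]
    exact ⟨c, Subtype.ext (hinj (g c).2 x.2 ((hg c).trans hc))⟩
  exact ⟨(OrderIso.symm ⟨Equiv.ofBijective g hbij, fun {c d} => hle c d⟩)⟩

/-- In `B₃` the elements `a` and `b` have too many covers, and each `cᵢ` is bypassed by `a` or `b`
in the interval between its neighbours. -/
theorem isBasicRetract [Finite P] (h : IsLayout S f) (hinj : Set.InjOn f S)
    (hmid : ∀ x ∈ S, f x ≠ .mid) : IsBasicRetract S := by
  refine isBasicRetract_iff.2 fun y x z hs => ?_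
  have hlt : ∀ {u v : P}, u ∈ S → v ∈ S → (f u < f v ↔ u < v) := fun hu hv => by
    rw [lt_iff_le_not_ge, h.le_iff hinj hu hv, h.le_iff hinj hv hu, ← lt_iff_le_not_ge]
  have key : ∀ ly lx lz : Label, ly < lx → lx < lz → lx ≠ .mid →
      (∀ k, k ≠ .mid → k < lx → k ≤ ly) → (∀ k, k ≠ .mid → lx < k → lz ≤ k) →
      ∃ k, k ≠ .mid ∧ ly < k ∧ k < lz ∧ k ≠ lx := by decide
  obtain ⟨k, hk, hyk, hkz, hkx⟩ := key (f y) (f x) (f z)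
    ((hlt hs.mem_left hs.mem).2 hs.left_lt) ((hlt hs.mem hs.mem_right).2 hs.lt_right)
    (hmid x hs.mem)
    (fun k hk hkx => by
      obtain ⟨w, hw, rfl⟩ := h.exists_eq k hk
      exact h.map_le w hw y hs.mem_left (hs.le_left w hw ((hlt hw hs.mem).1 hkx)))
    (fun k hk hkx => by
      obtain ⟨w, hw, rfl⟩ := h.exists_eq k hk
      exact h.map_le z hs.mem_right w hw (hs.right_le w hw ((hlt hs.mem hw).1 hkx)))
  obtain ⟨w, hw, rfl⟩ := h.exists_eq k hk
  exact hkx (congrArg f (hs.eq_of_between w hw ((hlt hs.mem_left hw).1 hyk)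
    ((hlt hw hs.mem_right).1 hkz)))

/-- A block with a layout has the basic block `B₃`. -/
theorem hasBasicBlock {L : Type*} [Lattice L] {f : L → Label} (hL : IsBlock L)
    (h : IsLayout (Set.univ : Set L) f) : HasBasicBlock L B3 := by
  obtain ⟨hfin, ⟨o, ho, hor⟩, ⟨i, hi, hir⟩⟩ := hL
  obtain ⟨T, hT, hlay, hinj, hmid⟩ := h.exists_reduced
  have h₁ := hasTwoAtoms_of_reflTransGen (hasTwoAtoms_univ_of_isMeetReducible ho hor) hT
  have h₂ := hasTwoCoatoms_of_reflTransGen (hasTwoCoatoms_univ_of_isJoinReducible hi hir) hT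
  exact ⟨T, ⟨T, ⟨hT, hlay.isBasicRetract hinj hmid⟩, .refl, not_isPendant h₁ h₂⟩,
    hlay.nonempty_orderIso_B3 hinj hmid⟩

end IsLayout
end RCLattice

/-! ### The lattice structure of a poset with a layout -/

namespace RCLattice

namespace IsLayout

section Poset

variable {P : Type*} [PartialOrder P] {S : Set P} {f : P → Label}

/-- Incomparable elements have incomparable labels. The join of two such labels is never `mid`, so
its chain is inhabited, and the least element of that chain is the supremum. -/
theorem exists_isLUB [Finite P] (h : IsLayout (Set.univ : Set P) f) (x y : P) :
    ∃ z, IsLUB {x, y} z := by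
  by_cases hxy : x ≤ y
  · exact ⟨y, by simp [hxy], fun w hw => hw (by simp)⟩
  by_cases hyx : y ≤ x
  · exact ⟨x, by simp [hyx], fun w hw => hw (by simp)⟩
  have h₁ : ¬ f x ≤ f y := fun hle => hle.lt_or_eq.elim
    (fun hl => hxy (h.lt_of_lt x trivial y trivial hl).le)
    fun he => (h.total x trivial y trivial he).elim hxy hyx
  have h₂ : ¬ f y ≤ f x := fun hle => hle.lt_or_eq.elim
    (fun hl => hyx (h.lt_of_lt y trivial x trivial hl).le)
    fun he => (h.total y trivial x trivial he).elim hyx hxy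
  have key : ∀ l m : Label, ¬ l ≤ m → ¬ m ≤ l →
      ∃ n, n ≠ .mid ∧ l < n ∧ m < n ∧ ∀ k, l ≤ k → m ≤ k → n ≤ k := by decide
  obtain ⟨n, hn, hxn, hyn, hmin⟩ := key _ _ h₁ h₂
  obtain ⟨z, -, hzn, hz⟩ := h.exists_fiber_min (h.exists_eq n hn)
  refine ⟨z, ?_, fun w hw => ?_⟩
  · simp only [upperBounds_insert, upperBounds_singleton, Set.mem_inter_iff, Set.mem_Ici]
    exact ⟨(h.lt_of_lt x trivial z trivial (hzn ▸ hxn)).le,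
      (h.lt_of_lt y trivial z trivial (hzn ▸ hyn)).le⟩
  · have := hmin (f w) (h.map_le x trivial w trivial (hw (by simp)))
      (h.map_le y trivial w trivial (hw (by simp)))
    rcases this.lt_or_eq with hl | he
    · exact (h.lt_of_lt z trivial w trivial (hzn ▸ hl)).le
    · exact hz w trivial he.symm

theorem exists_isGLB [Finite P] (h : IsLayout (Set.univ : Set P) f) (x y : P) :
    ∃ z, IsGLB {x, y} z :=
  h.dual.exists_isLUB (OrderDual.toDual x) (OrderDual.toDual y)

/-- A finite poset with a layout is a lattice. -/
noncomputable abbrev lattice [Finite P] (h : IsLayout (Set.univ : Set P) f) : Lattice P where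
  sup x y := (h.exists_isLUB x y).choose
  inf x y := (h.exists_isGLB x y).choose
  le_sup_left x y := (h.exists_isLUB x y).choose_spec.1 (by simp)
  le_sup_right x y := (h.exists_isLUB x y).choose_spec.1 (by simp)
  sup_le x y z hxz hyz := (h.exists_isLUB x y).choose_spec.2 (by simp [hxz, hyz])
  inf_le_left x y := (h.exists_isGLB x y).choose_spec.1 (by simp)
  inf_le_right x y := (h.exists_isGLB x y).choose_spec.1 (by simp)
  le_inf x y z hxy hxz := (h.exists_isGLB y z).choose_spec.2 (by simp [hxy, hxz])

end Poset

/-! ### The elements `0`, `a`, `b`, `1` and uniqueness of the layout -/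

section Frame

variable {P : Type*} [PartialOrder P] {f : P → Label} {o a b i : P}

/-- A layout of the whole poset together with the elements `0`, `a`, `b`, `1`. -/
structure Frame (f : P → Label) (o a b i : P) : Prop extends
    IsLayout (Set.univ : Set P) f where
  zero : f o = .zero
  low : f a = .low
  high : f b = .high
  one : f i = .one
  le_low : ∀ x, f x = .low → x ≤ a
  high_le : ∀ x, f x = .high → b ≤ x

theorem exists_frame [Finite P] (h : IsLayout (Set.univ : Set P) f) :
    ∃ o a b i, Frame f o a b i := by
  obtain ⟨o, -, ho⟩ := h.exists_eq .zero (by decide)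
  obtain ⟨i, -, hi⟩ := h.exists_eq .one (by decide)
  obtain ⟨a, -, ha, ha'⟩ := h.exists_fiber_max (h.exists_eq .low (by decide))
  obtain ⟨b, -, hb, hb'⟩ := h.exists_fiber_min (h.exists_eq .high (by decide))
  exact ⟨o, a, b, i, h, ho, ha, hb, hi, fun x => ha' x trivial, fun x => hb' x trivial⟩

namespace Frame

theorem flip (h : Frame f o a b i) : Frame (P := Pᵒᵈ) (fun x => (f (OrderDual.ofDual x)).flip)
    (OrderDual.toDual i) (OrderDual.toDual b) (OrderDual.toDual a) (OrderDual.toDual o) where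
  toIsLayout := h.toIsLayout.dual
  zero := congrArg Label.flip h.one
  low := congrArg Label.flip h.high
  high := congrArg Label.flip h.low
  one := congrArg Label.flip h.zero
  le_low _ hx := h.high_le _ (Label.flip_inj.1 hx)
  high_le _ hx := h.le_low _ (Label.flip_inj.1 hx)

theorem isLeast (h : Frame f o a b i) (x : P) : o ≤ x := h.zero_le trivial h.zero trivial

theorem isGreatest (h : Frame f o a b i) (x : P) : x ≤ i := h.le_one trivial h.one trivial

theorem eq_zero_iff (h : Frame f o a b i) {x : P} : f x = .zero ↔ x = o :=
  ⟨fun hx => h.zero_unique x trivial o trivial hx h.zero, fun hx => hx ▸ h.zero⟩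

theorem eq_one_iff (h : Frame f o a b i) {x : P} : f x = .one ↔ x = i :=
  ⟨fun hx => h.one_unique x trivial i trivial hx h.one, fun hx => hx ▸ h.one⟩

theorem le_low_iff (h : Frame f o a b i) {x : P} : x ≤ a ↔ f x ≤ .low := by
  refine ⟨fun hx => h.low ▸ h.map_le x trivial a trivial hx, fun hx => ?_⟩
  rcases hx.lt_or_eq with hl | he
  · exact (h.lt_of_lt x trivial a trivial (h.low ▸ hl)).le
  · exact h.le_low x he

theorem low_lt_iff (h : Frame f o a b i) {x : P} : a < x ↔ .low < f x := by
  refine ⟨fun hx => ?_, fun hx => h.lt_of_lt a trivial x trivial (h.low ▸ hx)⟩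
  rcases (h.low ▸ h.map_le a trivial x trivial hx.le : Label.low ≤ f x).lt_or_eq with hl | he
  · exact hl
  · exact absurd hx (h.le_low x he.symm).not_gt

theorem high_le_iff (h : Frame f o a b i) {x : P} : b ≤ x ↔ .high ≤ f x := by
  refine ⟨fun hx => h.high ▸ h.map_le b trivial x trivial hx, fun hx => ?_⟩
  rcases hx.lt_or_eq with hl | he
  · exact (h.lt_of_lt b trivial x trivial (h.high ▸ hl)).le
  · exact h.high_le x he.symm

theorem lt_high_iff (h : Frame f o a b i) {x : P} : x < b ↔ f x < .high := by
  refine ⟨fun hx => ?_, fun hx => h.lt_of_lt x trivial b trivial (h.high ▸ hx)⟩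
  rcases (h.high ▸ h.map_le x trivial b trivial hx.le : f x ≤ Label.high).lt_or_eq with hl | he
  · exact hl
  · exact absurd hx (h.high_le x he).not_gt

theorem low_lt_high (h : Frame f o a b i) : a < b := h.low_lt_iff.2 (by rw [h.high]; decide)

theorem zero_ne_low (h : Frame f o a b i) : o ≠ a := by
  rintro rfl; exact absurd (h.zero.symm.trans h.low) (by decide)

theorem high_ne_one (h : Frame f o a b i) : b ≠ i := by
  rintro rfl; exact absurd (h.high.symm.trans h.one) (by decide)

theorem low_ne_one (h : Frame f o a b i) : a ≠ i := by
  rintro rfl; exact absurd (h.low.symm.trans h.one) (by decide)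

theorem zero_ne_one (h : Frame f o a b i) : o ≠ i := by
  rintro rfl; exact absurd (h.zero.symm.trans h.one) (by decide)

theorem zero_ne_high (h : Frame f o a b i) : o ≠ b := by
  rintro rfl; exact absurd (h.zero.symm.trans h.high) (by decide)

theorem exists_greatest_lt [Finite P] (h : Frame f o a b i) {x : P} (hxo : x ≠ o) (hxb : x ≠ b)
    (hxi : x ≠ i) : ∃ y, y < x ∧ ∀ w, w < x → w ≤ y := by
  by_cases hfib : ∃ w ∈ Set.univ, f w = f x ∧ w < x
  · obtain ⟨y, -, -, hy, hmax⟩ := h.exists_greatest_lt_of_fiber trivial hfib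
    exact ⟨y, hy, fun w => hmax w trivial⟩
  · obtain ⟨y, -, -, hy, hmax⟩ := h.exists_greatest_lt_of_not_fiber trivial hfib
      (fun h0 => hxo (h.eq_zero_iff.1 h0))
      (fun hh => hfib ⟨b, trivial, h.high.trans hh.symm, (h.high_le x hh).lt_of_ne' hxb⟩)
      (fun h1 => hxi (h.eq_one_iff.1 h1))
    exact ⟨y, hy, fun w => hmax w trivial⟩

theorem exists_least_gt [Finite P] (h : Frame f o a b i) {x : P} (hxo : x ≠ o) (hxa : x ≠ a)
    (hxi : x ≠ i) : ∃ y, x < y ∧ ∀ w, x < w → y ≤ w :=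
  h.flip.exists_greatest_lt (x := OrderDual.toDual x) hxi hxa hxo

/-- The element `a` has no least strict upper bound. -/
theorem not_exists_least_gt_low (h : Frame f o a b i) : ¬ ∃ y, a < y ∧ ∀ w, a < w → y ≤ w := by
  rintro ⟨y, hy, hle⟩
  -- A least strict upper bound would be below both `b` and an element of `right`, but no label
  -- above `low` is at most both `high` and `right`.
  obtain ⟨c, -, hc⟩ := h.exists_eq .right (by decide)
  have h₁ := h.map_le y trivial c trivial (hle c (h.low_lt_iff.2 (by rw [hc]; decide)))
  have h₂ := h.map_le y trivial b trivial (hle b h.low_lt_high)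
  have h₃ := h.low_lt_iff.1 hy
  rw [hc] at h₁
  rw [h.high] at h₂
  revert h₁ h₂ h₃
  generalize f y = l
  revert l
  decide

/-- With respect to any layout, every element other than `0`, `a`, `1` has a least strict upper
bound. This characterises `a` by the order alone. -/
theorem low_unique [Finite P] {g : P → Label} {o' a' b' i' : P} (h : Frame f o a b i)
    (h' : Frame g o' a' b' i') : a = a' := by
  have ho : o = o' := (h.isLeast _).antisymm (h'.isLeast _)
  have hi : i = i' := (h'.isGreatest _).antisymm (h.isGreatest _)
  by_contra hne
  exact h.not_exists_least_gt_low (h'.exists_least_gt (ho ▸ h.zero_ne_low.symm) hne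
    (hi ▸ h.low_ne_one))

end Frame

/-- A finite poset has at most one layout. -/
theorem unique [Finite P] {g : P → Label} (hf : IsLayout (Set.univ : Set P) f)
    (hg : IsLayout (Set.univ : Set P) g) : f = g := by
  obtain ⟨o, a, b, i, h⟩ := hf.exists_frame
  obtain ⟨o', a', b', i', h'⟩ := hg.exists_frame
  obtain rfl : o = o' := (h.isLeast _).antisymm (h'.isLeast _)
  obtain rfl : i = i' := (h'.isGreatest _).antisymm (h.isGreatest _)
  obtain rfl := h.low_unique h'
  obtain rfl : b = b' := h.flip.low_unique h'.flip
  funext x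
  -- A label is determined by the comparisons with `0`, `a`, `b`, `1`, which do not refer to the
  -- layout.
  have key : ∀ l m : Label, (l = .zero ↔ m = .zero) → (l = .one ↔ m = .one) →
      (l ≤ .low ↔ m ≤ .low) → (.low < l ↔ .low < m) → (.high ≤ l ↔ .high ≤ m) →
      (l < .high ↔ m < .high) → l = m := by decide
  exact key _ _ (h.eq_zero_iff.trans h'.eq_zero_iff.symm) (h.eq_one_iff.trans h'.eq_one_iff.symm)
    (h.le_low_iff.symm.trans h'.le_low_iff) (h.low_lt_iff.symm.trans h'.low_lt_iff)
    (h.high_le_iff.symm.trans h'.high_le_iff) (h.lt_high_iff.symm.trans h'.lt_high_iff)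

end Frame

/-! ### Reducible elements -/

section Reducible

variable {L : Type*} [Lattice L] {f : L → Label} {o a b i : L}

theorem _root_.RCLattice.not_isJoinReducible {x y : L} (hyx : y < x) (hy : ∀ w, w < x → w ≤ y) :
    ¬ IsJoinReducible x := by
  rintro ⟨u, v, hu, hv, rfl⟩
  exact hyx.not_ge (sup_le (hy u (le_sup_left.lt_of_ne hu)) (hy v (le_sup_right.lt_of_ne hv)))

theorem Frame.isJoinReducible_high (h : Frame f o a b i) : IsJoinReducible b := by
  obtain ⟨c, -, hc⟩ := h.exists_eq .left (by decide)
  have hcb : c < b := h.lt_high_iff.2 (by rw [hc]; decide)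
  refine ⟨a, c, h.low_lt_high.ne, hcb.ne, (sup_le h.low_lt_high.le hcb.le).antisymm ?_⟩
  have h₁ := h.map_le a trivial (a ⊔ c) trivial le_sup_left
  have h₂ := h.map_le c trivial (a ⊔ c) trivial le_sup_right
  rw [h.high_le_iff]
  rw [h.low] at h₁
  rw [hc] at h₂
  revert h₁ h₂
  generalize f (a ⊔ c) = l
  revert l
  decide

theorem Frame.isJoinReducible_one (h : Frame f o a b i) : IsJoinReducible i := by
  obtain ⟨c, -, hc⟩ := h.exists_eq .outer (by decide)
  refine ⟨b, c, h.high_ne_one, ?_, ?_⟩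
  · rintro rfl; exact absurd (hc.symm.trans h.one) (by decide)
  have h₁ := h.map_le b trivial (b ⊔ c) trivial le_sup_left
  have h₂ := h.map_le c trivial (b ⊔ c) trivial le_sup_right
  rw [← h.eq_one_iff]
  rw [h.high] at h₁
  rw [hc] at h₂
  revert h₁ h₂
  generalize f (b ⊔ c) = l
  revert l
  decide

theorem Frame.isJoinReducible_iff [Finite L] (h : Frame f o a b i) {x : L} :
    IsJoinReducible x ↔ x = b ∨ x = i := by
  constructor
  · intro hx
    by_contra! hcon
    by_cases hxo : x = o
    · obtain ⟨u, v, hu, hv, huv⟩ := hx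
      exact hu (hxo ▸ (hxo ▸ huv ▸ le_sup_left : u ≤ o).antisymm (h.isLeast u))
    · obtain ⟨y, hy, hmax⟩ := h.exists_greatest_lt hxo hcon.1 hcon.2
      exact not_isJoinReducible hy hmax hx
  · rintro (rfl | rfl)
    · exact h.isJoinReducible_high
    · exact h.isJoinReducible_one

theorem Frame.isMeetReducible_iff [Finite L] (h : Frame f o a b i) {x : L} :
    IsMeetReducible x ↔ x = a ∨ x = o :=
  h.flip.isJoinReducible_iff (x := OrderDual.toDual x)

theorem Frame.reducibles_eq [Finite L] (h : Frame f o a b i) : reducibles L = {o, a, b, i} := by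
  ext x
  simp only [reducibles, Set.mem_ofPred_eq, h.isJoinReducible_iff, h.isMeetReducible_iff,
    Set.mem_insert_iff, Set.mem_singleton_iff]
  tauto

theorem Frame.ncard_reducibles [Finite L] (h : Frame f o a b i) : (reducibles L).ncard = 4 := by
  rw [h.reducibles_eq, Set.ncard_insert_of_notMem, Set.ncard_insert_of_notMem, Set.ncard_pair]
  · exact h.high_ne_one
  · simp [h.low_lt_high.ne, h.low_ne_one]
  · simp [h.zero_ne_low, h.zero_ne_high, h.zero_ne_one]

theorem Frame.reducibles_total [Finite L] (h : Frame f o a b i) :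
    ∀ x ∈ reducibles L, ∀ y ∈ reducibles L, x ≤ y ∨ y ≤ x := by
  rw [h.reducibles_eq]
  have := h.low_lt_high.le
  rintro x (rfl | rfl | rfl | rfl) y (rfl | rfl | rfl | rfl) <;>
    first
      | exact Or.inl le_rfl
      | exact Or.inl (h.isLeast _)
      | exact Or.inr (h.isLeast _)
      | exact Or.inl (h.isGreatest _)
      | exact Or.inr (h.isGreatest _)
      | exact Or.inl this
      | exact Or.inr this

theorem Frame.isBlock [Finite L] (h : Frame f o a b i) : IsBlock L :=
  ⟨inferInstance, ⟨o, h.isLeast, h.isMeetReducible_iff.2 (Or.inr rfl)⟩,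
    ⟨i, h.isGreatest, h.isJoinReducible_one⟩⟩

end Reducible

end IsLayout
end RCLattice

/-! ### Nullity -/

namespace RCLattice

section Nullity

variable {P : Type*} [PartialOrder P]

theorem setOf_covBy_eq {x : P} {U : Set P} (hU : IsAntichain (· ≤ ·) U)
    (h : ∀ w, w < x ↔ ∃ u ∈ U, w ≤ u) : {w | w ⋖ x} = U := by
  ext w
  constructor
  · intro hw
    obtain ⟨u, hu, hwu⟩ := (h w).1 hw.lt
    have hux : u < x := (h u).2 ⟨u, hu, le_rfl⟩
    exact hwu.eq_of_not_lt (fun hlt => hw.2 hlt hux) ▸ hu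
  · intro hw
    refine ⟨(h w).2 ⟨w, hw, le_rfl⟩, fun v hwv hvx => ?_⟩
    obtain ⟨u, hu, hvu⟩ := (h v).1 hvx
    have := hU.eq hw hu (hwv.le.trans hvu)
    subst this
    exact hwv.not_ge hvu

/-- Each edge of the cover graph is counted at its upper end. -/
theorem ncard_edgeSet_hasse [Fintype P] :
    (SimpleGraph.hasse P).edgeSet.ncard = ∑ x : P, {w : P | w ⋖ x}.ncard := by
  have himg : (SimpleGraph.hasse P).edgeSet =
      (fun p : Σ x : P, {w : P // w ⋖ x} => s(p.2.1, p.1)) '' Set.univ := by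
    ext e
    induction e using Sym2.ind with
    | _ x y =>
      rw [SimpleGraph.mem_edgeSet, SimpleGraph.hasse_adj]
      constructor
      · rintro (h | h)
        · exact ⟨⟨y, x, h⟩, trivial, rfl⟩
        · exact ⟨⟨x, y, h⟩, trivial, Sym2.eq_swap⟩
      · rintro ⟨⟨u, v, h⟩, -, he⟩
        rcases Sym2.eq_iff.1 he with ⟨rfl, rfl⟩ | ⟨rfl, rfl⟩
        · exact Or.inl h
        · exact Or.inr h
  have hinj : Function.Injective (fun p : Σ x : P, {w : P // w ⋖ x} => s(p.2.1, p.1)) := by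
    rintro ⟨x, w, h⟩ ⟨y, v, h'⟩ he
    rcases Sym2.eq_iff.1 he with ⟨h₁, h₂⟩ | ⟨h₁, h₂⟩
    · simp only at h₁ h₂
      subst h₁; subst h₂; rfl
    · simp only at h₁ h₂
      subst h₁; subst h₂
      exact absurd h.lt h'.lt.asymm
  rw [himg, Set.ncard_image_of_injective _ hinj, Set.ncard_univ, Nat.card_sigma]
  rfl

theorem hasse_connected [Finite P] {o : P} (ho : ∀ x, o ≤ x) :
    (SimpleGraph.hasse P).Connected := by
  have : Fintype P := Fintype.ofFinite P
  classical
  have : LocallyFiniteOrder P := Fintype.toLocallyFiniteOrder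
  have hreach : ∀ x, (SimpleGraph.hasse P).Reachable o x := by
    intro x
    induction le_iff_reflTransGen_covBy.1 (ho x) with
    | refl => exact SimpleGraph.Reachable.refl _
    | tail _ h ih => exact ih.trans (SimpleGraph.Adj.reachable (Or.inl h))
  have : Nonempty P := ⟨o⟩
  exact ⟨fun x y => (hreach x).symm.trans (hreach y)⟩

theorem nullity_eq [Fintype P] {o : P} (ho : ∀ x, o ≤ x) :
    nullity P = ((∑ x : P, {w : P | w ⋖ x}.ncard : ℕ) : ℤ) - Fintype.card P + 1 := by
  have hcard : Nat.card (SimpleGraph.hasse P).ConnectedComponent = 1 := by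
    rw [Nat.card_eq_one_iff_unique]
    have hc := hasse_connected ho
    exact ⟨hc.preconnected.subsingleton_connectedComponent,
      ⟨(SimpleGraph.hasse P).connectedComponentMk o⟩⟩
  rw [nullity, ncard_edgeSet_hasse, hcard, Nat.card_eq_fintype_card, Nat.cast_one]

end Nullity

namespace IsLayout.Frame

variable {P : Type*} [PartialOrder P] {f : P → Label} {o a b i : P}

theorem ncard_covBy_zero (h : Frame f o a b i) : {w | w ⋖ o}.ncard = 0 := by
  have : {w | w ⋖ o} = ∅ := Set.eq_empty_of_forall_notMem fun w hw => hw.lt.not_ge (h.isLeast w)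
  rw [this, Set.ncard_empty]

theorem ncard_covBy_of_ne [Finite P] (h : Frame f o a b i) {x : P} (hxo : x ≠ o) (hxb : x ≠ b)
    (hxi : x ≠ i) : {w | w ⋖ x}.ncard = 1 := by
  obtain ⟨y, hy, hmax⟩ := h.exists_greatest_lt hxo hxb hxi
  rw [setOf_covBy_eq (U := {y}) (Set.subsingleton_singleton.isAntichain _) fun w =>
    ⟨fun hw => ⟨y, rfl, hmax w hw⟩, by rintro ⟨_, rfl, hw⟩; exact hw.trans_lt hy⟩,
    Set.ncard_singleton]

theorem not_le_of_label (h : Frame f o a b i) {x y : P} (hxy : ¬ f x ≤ f y) : ¬ x ≤ y :=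
  fun hle => hxy (h.map_le x trivial y trivial hle)

theorem ncard_covBy_high [Finite P] (h : Frame f o a b i) : {w | w ⋖ b}.ncard = 2 := by
  obtain ⟨c, -, hc, hcmax⟩ := h.exists_fiber_max (h.exists_eq .left (by decide))
  -- The chains `low` and `mid` are taken together because `mid` may be empty; then `m` is `a`
  -- itself.
  obtain ⟨m, -, hm, hmmax⟩ := exists_greatest_of_total (S := Set.univ)
    (p := fun w => f w = .low ∨ f w = .mid) ⟨a, trivial, Or.inl h.low⟩ (by
      rintro x - y - (hx | hx) (hy | hy)
      · exact h.total x trivial y trivial (hx.trans hy.symm)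
      · exact Or.inl (h.lt_of_lt x trivial y trivial (by rw [hx, hy]; decide)).le
      · exact Or.inr (h.lt_of_lt y trivial x trivial (by rw [hx, hy]; decide)).le
      · exact h.total x trivial y trivial (hx.trans hy.symm))
  have hcm : ¬ c ≤ m := h.not_le_of_label (by rcases hm with hm | hm <;> rw [hc, hm] <;> decide)
  have hmc : ¬ m ≤ c := h.not_le_of_label (by rcases hm with hm | hm <;> rw [hc, hm] <;> decide)
  rw [setOf_covBy_eq (U := {c, m}), Set.ncard_pair (fun hcm' => hcm hcm'.le)]
  · rintro x (rfl | rfl) y (rfl | rfl) hne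
    exacts [(hne rfl).elim, hcm, hmc, (hne rfl).elim]
  · intro w
    constructor
    · intro hw
      have key : ∀ l : Label, l < .high → l = .zero ∨ l = .left ∨ l = .low ∨ l = .mid := by decide
      rcases key _ (h.lt_high_iff.1 hw) with hl | hl | hl
      · exact ⟨c, by simp, h.eq_zero_iff.1 hl ▸ h.isLeast c⟩
      · exact ⟨c, by simp, hcmax w trivial hl⟩
      · exact ⟨m, by simp, hmmax w trivial hl⟩
    · rintro ⟨u, rfl | rfl, hwu⟩
      · exact hwu.trans_lt (h.lt_high_iff.2 (by rw [hc]; decide))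
      · exact hwu.trans_lt (h.lt_high_iff.2 (by rcases hm with hm | hm <;> rw [hm] <;> decide))

theorem ncard_covBy_one [Finite P] (h : Frame f o a b i) : {w | w ⋖ i}.ncard = 3 := by
  obtain ⟨c, -, hc, hcmax⟩ := h.exists_fiber_max (h.exists_eq .high (by decide))
  obtain ⟨d, -, hd, hdmax⟩ := h.exists_fiber_max (h.exists_eq .right (by decide))
  obtain ⟨e, -, he, hemax⟩ := h.exists_fiber_max (h.exists_eq .outer (by decide))
  have hcd : ¬ c ≤ d := h.not_le_of_label (by rw [hc, hd]; decide)
  have hdc : ¬ d ≤ c := h.not_le_of_label (by rw [hc, hd]; decide)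
  have hce : ¬ c ≤ e := h.not_le_of_label (by rw [hc, he]; decide)
  have hec : ¬ e ≤ c := h.not_le_of_label (by rw [hc, he]; decide)
  have hde : ¬ d ≤ e := h.not_le_of_label (by rw [hd, he]; decide)
  have hed : ¬ e ≤ d := h.not_le_of_label (by rw [hd, he]; decide)
  rw [setOf_covBy_eq (U := {c, d, e}), Set.ncard_insert_of_notMem,
    Set.ncard_pair (fun h => hde h.le)]
  · rintro (rfl | rfl)
    exacts [hcd le_rfl, hce le_rfl]
  · rintro x (rfl | rfl | rfl) y (rfl | rfl | rfl) hne
    exacts [(hne rfl).elim, hcd, hce, hdc, (hne rfl).elim, hde, hec, hed, (hne rfl).elim]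
  · intro w
    constructor
    · intro hw
      have key : ∀ l : Label, l ≠ .one → l < .high ∨ l = .high ∨ l = .right ∨ l = .outer := by
        decide
      rcases key _ (fun h1 => hw.ne (h.eq_one_iff.1 h1)) with hl | hl | hl | hl
      · exact ⟨c, by simp, (h.lt_of_lt w trivial c trivial (hc ▸ hl)).le⟩
      · exact ⟨c, by simp, hcmax w trivial hl⟩
      · exact ⟨d, by simp, hdmax w trivial hl⟩
      · exact ⟨e, by simp, hemax w trivial hl⟩
    · have hlt : ∀ u, f u ≠ .one → u < i := fun u hu =>
        (h.isGreatest u).lt_of_ne fun hui => hu (h.eq_one_iff.2 hui)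
      rintro ⟨u, rfl | rfl | rfl, hwu⟩
      · exact hwu.trans_lt (hlt _ (by rw [hc]; decide))
      · exact hwu.trans_lt (hlt _ (by rw [hd]; decide))
      · exact hwu.trans_lt (hlt _ (by rw [he]; decide))

theorem nullity_eq_three [Finite P] (h : Frame f o a b i) : nullity P = 3 := by
  classical
  have : Fintype P := Fintype.ofFinite P
  -- Lower covers minus one is `-1` at `0`, `1` at `b`, `2` at the top and zero elsewhere, so edges
  -- exceed vertices by two; the single component adds one. The term for `0` stands on the left to
  -- avoid subtraction in `ℕ`.
  have hsum : ∀ x : P, {w | w ⋖ x}.ncard + (if x = o then 1 else 0) =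
      1 + (if x = b then 1 else 0) + (if x = i then 2 else 0) := by
    intro x
    by_cases hxo : x = o
    · subst hxo
      simp [h.ncard_covBy_zero, h.zero_ne_high, h.zero_ne_one]
    by_cases hxb : x = b
    · subst hxb
      simp [h.ncard_covBy_high, h.zero_ne_high.symm, h.high_ne_one]
    by_cases hxi : x = i
    · subst hxi
      simp [h.ncard_covBy_one, h.zero_ne_one.symm, h.high_ne_one.symm]
    simp [h.ncard_covBy_of_ne hxo hxb hxi, hxo, hxb, hxi]
  have htotal := Finset.sum_congr (rfl : (Finset.univ : Finset P) = Finset.univ)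
    fun x _ => hsum x
  simp only [Finset.sum_add_distrib, Finset.sum_ite_eq', Finset.mem_univ, if_true,
    Finset.sum_const, Finset.card_univ, smul_eq_mul, mul_one] at htotal
  rw [nullity_eq h.isLeast]
  omega

end IsLayout.Frame

/-- The conditions on reducible elements and nullity follow from the layout, so they do not restrict
the class further. -/
theorem mem_blockClassB3_iff {j : ℕ} {L : LatticeOn j} :
    L ∈ blockClassB3 j ↔ ∃ f, IsLayout (Set.univ : Set L.carrier) f := by
  constructor
  · rintro ⟨⟨hblock, -⟩, hbasic⟩
    exact exists_isLayout_of_hasBasicBlock hblock hbasic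
  · rintro ⟨f, hf⟩
    obtain ⟨o, a, b, i, h⟩ := hf.exists_frame
    exact ⟨⟨h.isBlock, h.ncard_reducibles, h.reducibles_total, h.nullity_eq_three⟩,
      hf.hasBasicBlock h.isBlock⟩

end RCLattice

/-! ### Counting by chain lengths -/

namespace RCLattice

open Label in
/-- The labels whose chains have variable length. -/
def variableLabels : Finset Label := {low, mid, high, left, right, outer}

/-- The excess lengths of the chains in a layout of a poset with `j` elements. -/
def excessLengths (j : ℕ) : Finset (Label →₀ ℕ) := variableLabels.finsuppAntidiag (j - 7)

/-- The least possible length of the chain at a label. -/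
def minLength (l : Label) : ℕ := if l = .mid then 0 else 1

/-- The lexicographic sum of chains with `n l` elements at each label `l`. -/
def chainSum (n : Label → ℕ) : Set (Label ×ₗ ℕ) := {p | (ofLex p).2 < n (ofLex p).1}

/-- The label of an element of a lexicographic sum of chains. -/
def chainLabel {n : Label → ℕ} (p : chainSum n) : Label := (ofLex (p : Label ×ₗ ℕ)).1

/-- A lexicographic sum of chains as a disjoint union of initial segments. -/
def chainSumEquiv (n : Label → ℕ) : chainSum n ≃ Σ l, Fin (n l) where
  toFun p := ⟨chainLabel p, ⟨(ofLex (p : Label ×ₗ ℕ)).2, p.2⟩⟩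
  invFun q := ⟨toLex (q.1, q.2), q.2.2⟩
  left_inv _ := rfl
  right_inv _ := rfl

instance (n : Label → ℕ) : Finite (chainSum n) := Finite.of_equiv _ (chainSumEquiv n).symm

theorem card_chainSum (n : Label → ℕ) : Nat.card (chainSum n) = ∑ l, n l := by
  rw [Nat.card_congr (chainSumEquiv n), Nat.card_sigma]
  simp

theorem ncard_chainLabel (n : Label → ℕ) (l : Label) :
    {p : chainSum n | chainLabel p = l}.ncard = n l := by
  have hrange : {p : chainSum n | chainLabel p = l} =
      Set.range fun k : Fin (n l) => (chainSumEquiv n).symm ⟨l, k⟩ := by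
    ext p
    constructor
    · rintro rfl
      exact ⟨⟨(ofLex (p : Label ×ₗ ℕ)).2, p.2⟩, rfl⟩
    · rintro ⟨k, rfl⟩
      rfl
  have hinj : Function.Injective fun k : Fin (n l) => (chainSumEquiv n).symm ⟨l, k⟩ :=
    (chainSumEquiv n).symm.injective.comp sigma_mk_injective
  rw [hrange, ← Set.image_univ, Set.ncard_image_of_injective _ hinj, Set.ncard_univ, Nat.card_fin]

theorem isLayout_chainLabel {n : Label → ℕ} (h0 : n .zero = 1) (h1 : n .one = 1)
    (hn : ∀ l, l ≠ .mid → 0 < n l) :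
    IsLayout (Set.univ : Set (chainSum n)) chainLabel where
  lt_of_lt x _ y _ hxy := Prod.Lex.lt_iff.2 (Or.inl hxy)
  map_le x _ y _ hxy := Prod.Lex.monotone_fst _ _ hxy
  total x _ y _ hxy := (le_total (ofLex (x : Label ×ₗ ℕ)).2 (ofLex (y : Label ×ₗ ℕ)).2).imp
    (fun h => Prod.Lex.le_iff.2 (Or.inr ⟨hxy, h⟩))
    (fun h => Prod.Lex.le_iff.2 (Or.inr ⟨hxy.symm, h⟩))
  zero_unique x _ y _ hx hy := by
    obtain ⟨w, hw⟩ := Set.ncard_eq_one.1 ((ncard_chainLabel n .zero).trans h0)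
    exact (hw.le hx : x = w).trans (hw.le hy : y = w).symm
  one_unique x _ y _ hx hy := by
    obtain ⟨w, hw⟩ := Set.ncard_eq_one.1 ((ncard_chainLabel n .one).trans h1)
    exact (hw.le hx : x = w).trans (hw.le hy : y = w).symm
  exists_eq l hl := ⟨(chainSumEquiv n).symm ⟨l, ⟨0, hn l hl⟩⟩, trivial, rfl⟩

namespace IsLayout

variable {P Q : Type*} [PartialOrder P] [PartialOrder Q] {f : P → Label}

theorem comp_orderIso {g : Q → Label} (h : IsLayout (Set.univ : Set Q) g) (e : P ≃o Q) :
    IsLayout (Set.univ : Set P) (g ∘ e) where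
  lt_of_lt x _ y _ hxy := e.lt_iff_lt.1 (h.lt_of_lt _ trivial _ trivial hxy)
  map_le x _ y _ hxy := h.map_le _ trivial _ trivial (e.monotone hxy)
  total x _ y _ hxy := (h.total _ trivial _ trivial hxy).imp e.le_iff_le.1 e.le_iff_le.1
  zero_unique x _ y _ hx hy := e.injective (h.zero_unique _ trivial _ trivial hx hy)
  one_unique x _ y _ hx hy := e.injective (h.one_unique _ trivial _ trivial hx hy)
  exists_eq l hl := by
    obtain ⟨y, -, hy⟩ := h.exists_eq l hl
    exact ⟨e.symm y, trivial, by simp [hy]⟩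

/-- The layout of `Q` pulled back along `e` is a layout of `P`, hence equal to `f` by uniqueness. So
chain lengths are isomorphism invariants. -/
theorem ncard_fiber_eq [Finite P] {g : Q → Label} (hf : IsLayout (Set.univ : Set P) f)
    (hg : IsLayout (Set.univ : Set Q) g) (e : P ≃o Q) (l : Label) :
    {x | f x = l}.ncard = {y | g y = l}.ncard := by
  rw [hf.unique (hg.comp_orderIso e), ← Set.ncard_image_of_injective _ e.injective]
  congr 1
  ext y
  exact ⟨by rintro ⟨x, hx, rfl⟩; exact hx, fun hy => ⟨e.symm y, by simpa using hy, by simp⟩⟩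

theorem sum_ncard_fiber {X : Type*} [Finite X] (f : X → Label) :
    ∑ l, {x | f x = l}.ncard = Nat.card X := by
  rw [← Nat.card_congr (Equiv.sigmaFiberEquiv f), Nat.card_sigma]
  rfl

/-- A finite poset with a layout is the lexicographic sum of the chains of the layout. -/
theorem nonempty_orderIso_chainSum [Finite P] (h : IsLayout (Set.univ : Set P) f) :
    Nonempty (P ≃o chainSum fun l => {x | f x = l}.ncard) := by
  have hlt : ∀ {x y : P}, f x = f y → x < y →
      {w | f w = f x ∧ w < x}.ncard < {w | f w = f y ∧ w < y}.ncard := fun {x y} hxy hlt =>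
    Set.ncard_lt_ncard ⟨fun w hw => ⟨hw.1.trans hxy, hw.2.trans hlt⟩,
      fun hsub => lt_irrefl _ (hsub (show x ∈ {w | f w = f y ∧ w < y} from ⟨hxy, hlt⟩)).2⟩
  -- An element goes to its label and its height in the chain, that is, the number of elements of
  -- the chain strictly below it. Surjectivity will follow by cardinality.
  let e : P → chainSum fun l => {x | f x = l}.ncard := fun x =>
    ⟨toLex (f x, {w | f w = f x ∧ w < x}.ncard),
      Set.ncard_lt_ncard ⟨fun w hw => hw.1, fun hsub => lt_irrefl _ (hsub (rfl : f x = f x)).2⟩⟩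
  have hle : ∀ {x y : P}, e x ≤ e y ↔ x ≤ y := by
    intro x y
    have hiff : e x ≤ e y ↔ f x < f y ∨ f x = f y ∧
        {w | f w = f x ∧ w < x}.ncard ≤ {w | f w = f y ∧ w < y}.ncard := Prod.Lex.le_iff
    rw [hiff]
    constructor
    · rintro (hl | ⟨he, hl⟩)
      · exact (h.lt_of_lt x trivial y trivial hl).le
      · refine (h.total x trivial y trivial he).elim id fun hyx => ?_
        exact (hyx.eq_of_not_lt fun hlt' => (hlt he.symm hlt').not_ge hl).ge
    · intro hxy
      rcases (h.map_le x trivial y trivial hxy).lt_or_eq with hl | he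
      · exact Or.inl hl
      · refine Or.inr ⟨he, ?_⟩
        rcases hxy.lt_or_eq with hl | rfl
        · exact (hlt he hl).le
        · exact le_rfl
  have hinj : Function.Injective e := fun x y hxy => (hle.1 hxy.le).antisymm (hle.1 hxy.ge)
  have hcard : Nat.card P = Nat.card (chainSum fun l => {x | f x = l}.ncard) := by
    rw [card_chainSum, sum_ncard_fiber]
  have hbij : Function.Bijective e :=
    (Nat.bijective_iff_injective_and_card e).2 ⟨hinj, hcard⟩
  exact ⟨⟨Equiv.ofBijective e hbij, hle⟩⟩

end IsLayout

theorem sum_minLength : ∑ l, minLength l = 7 := by decide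

theorem sum_eq_sum_variableLabels {n : Label → ℕ} (h0 : n .zero = 0) (h1 : n .one = 0) :
    ∑ l, n l = ∑ l ∈ variableLabels, n l := by
  refine (Finset.sum_subset (Finset.subset_univ _) fun l _ hl => ?_).symm
  cases l
  case zero => exact h0
  case one => exact h1
  all_goals exact absurd (by decide) hl

theorem mem_excessLengths {j : ℕ} {φ : Label →₀ ℕ} :
    φ ∈ excessLengths j ↔ φ .zero = 0 ∧ φ .one = 0 ∧ ∑ l, φ l = j - 7 := by
  rw [excessLengths, Finset.mem_finsuppAntidiag]
  constructor
  · rintro ⟨hsum, hsupp⟩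
    have h0 : φ .zero = 0 := by
      by_contra h; exact absurd (hsupp (Finsupp.mem_support_iff.2 h)) (by decide)
    have h1 : φ .one = 0 := by
      by_contra h; exact absurd (hsupp (Finsupp.mem_support_iff.2 h)) (by decide)
    exact ⟨h0, h1, (sum_eq_sum_variableLabels h0 h1).trans hsum⟩
  · rintro ⟨h0, h1, hsum⟩
    refine ⟨(sum_eq_sum_variableLabels h0 h1).symm.trans hsum, fun l hl => ?_⟩
    cases l
    case zero => exact absurd h0 (Finsupp.mem_support_iff.1 hl)
    case one => exact absurd h1 (Finsupp.mem_support_iff.1 hl)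
    all_goals decide

theorem isLayout_of_mem_excessLengths {j : ℕ} {φ : Label →₀ ℕ} (h : φ ∈ excessLengths j) :
    IsLayout (Set.univ : Set (chainSum fun l => φ l + minLength l)) chainLabel := by
  obtain ⟨h0, h1, -⟩ := mem_excessLengths.1 h
  refine isLayout_chainLabel (by rw [h0]; rfl) (by rw [h1]; rfl) fun l hl => ?_
  rw [minLength, if_neg hl]
  exact Nat.succ_pos _

/-- The lattice with the given excess lengths of chains. -/
noncomputable def latticeOfLengths {j : ℕ} (hj : 7 ≤ j) (φ : excessLengths j) : LatticeOn j :=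
  letI : Lattice (chainSum fun l => φ.1 l + minLength l) :=
    (isLayout_of_mem_excessLengths φ.2).lattice
  { carrier := chainSum fun l => φ.1 l + minLength l
    card_eq := by
      rw [card_chainSum, Finset.sum_add_distrib, sum_minLength, (mem_excessLengths.1 φ.2).2.2]
      omega }

theorem latticeOfLengths_injective {j : ℕ} (hj : 7 ≤ j) :
    Function.Injective fun φ => Quotient.mk (LatticeOn.isoSetoid j) (latticeOfLengths hj φ) := by
  intro φ ψ h
  obtain ⟨e⟩ : Nonempty ((chainSum fun l => φ.1 l + minLength l) ≃o
    (chainSum fun l => ψ.1 l + minLength l)) := Quotient.exact h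
  refine Subtype.ext (Finsupp.ext fun l => ?_)
  have := (isLayout_of_mem_excessLengths φ.2).ncard_fiber_eq
    (isLayout_of_mem_excessLengths ψ.2) e l
  rw [ncard_chainLabel, ncard_chainLabel] at this
  exact Nat.add_right_cancel this

theorem exists_latticeOfLengths {j : ℕ} (hj : 7 ≤ j) {L : LatticeOn j} (hL : L ∈ blockClassB3 j) :
    ∃ φ, Nonempty ((latticeOfLengths hj φ).carrier ≃o L.carrier) := by
  obtain ⟨f, hf⟩ := mem_blockClassB3_iff.1 hL
  have hmin : ∀ l, minLength l ≤ {x | f x = l}.ncard := by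
    intro l
    rw [minLength]
    split_ifs with hl
    · exact Nat.zero_le _
    · obtain ⟨x, -, hx⟩ := hf.exists_eq l hl
      exact (Set.ncard_pos (Set.toFinite _)).2 ⟨x, hx⟩
  have hsub : ∀ l, {x | f x = l}.ncard - minLength l + minLength l = {x | f x = l}.ncard :=
    fun l => Nat.sub_add_cancel (hmin l)
  have hφ : Finsupp.equivFunOnFinite.symm (fun l => {x | f x = l}.ncard - minLength l) ∈
      excessLengths j := by
    rw [mem_excessLengths]
    refine ⟨?_, ?_, ?_⟩
    -- The chains at `zero` and `one` are singletons, so they carry no excess.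
    · refine Nat.sub_eq_zero_of_le ((Set.ncard_le_one (Set.toFinite _)).2 ?_)
      exact fun x hx y hy => hf.zero_unique x trivial y trivial hx hy
    · refine Nat.sub_eq_zero_of_le ((Set.ncard_le_one (Set.toFinite _)).2 ?_)
      exact fun x hx y hy => hf.one_unique x trivial y trivial hx hy
    · have hsum := (Finset.sum_congr rfl fun l _ => hsub l).trans (IsLayout.sum_ncard_fiber f)
      rw [Finset.sum_add_distrib, sum_minLength, L.card_eq] at hsum
      simp only [Finsupp.equivFunOnFinite_symm_apply_apply]
      omega
  obtain ⟨e⟩ := hf.nonempty_orderIso_chainSum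
  refine ⟨⟨_, hφ⟩, ?_⟩
  have hlen : (fun l => Finsupp.equivFunOnFinite.symm
      (fun l => {x | f x = l}.ncard - minLength l) l + minLength l) =
      fun l => {x | f x = l}.ncard := funext hsub
  change Nonempty ((chainSum fun l => Finsupp.equivFunOnFinite.symm
      (fun l => {x | f x = l}.ncard - minLength l) l + minLength l) ≃o L.carrier)
  rw [hlen]
  exact ⟨e.symm⟩

theorem numNonisomorphic_blockClassB3 {j : ℕ} (hj : 7 ≤ j) :
    numNonisomorphic (blockClassB3 j) = (j - 2).choose 5 := by
  have hrange : Quotient.mk (LatticeOn.isoSetoid j) '' blockClassB3 j =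
      Set.range fun φ => Quotient.mk (LatticeOn.isoSetoid j) (latticeOfLengths hj φ) := by
    ext q
    constructor
    · rintro ⟨L, hL, rfl⟩
      obtain ⟨φ, hφ⟩ := exists_latticeOfLengths hj hL
      exact ⟨φ, Quotient.sound hφ⟩
    · rintro ⟨φ, rfl⟩
      exact ⟨_, mem_blockClassB3_iff.2 ⟨_, isLayout_of_mem_excessLengths φ.2⟩, rfl⟩
  have hcard : variableLabels.card = 6 := by decide
  rw [numNonisomorphic, hrange, ← Set.image_univ,
    Set.ncard_image_of_injective _ (latticeOfLengths_injective hj), Set.ncard_univ,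
    Nat.card_eq_fintype_card, Fintype.card_coe, excessLengths,
    Finset.card_finsuppAntidiag_nat_eq_choose, hcard,
    show 6 + (j - 7) - 1 = j - 2 by omega]
  -- Stars and bars gives the lower index `j - 7`, complementary to `5` in `j - 2`.
  exact Nat.choose_symm_of_eq_add (by omega)

/-- Hockey-stick identity: as `p` runs from `1` to `j - 6`, the upper index runs from `j - 3` down
to `4`. -/
theorem sum_choose_four {j : ℕ} (hj : 7 ≤ j) :
    ∑ p ∈ Finset.Icc 1 (j - 6), (j - p - 2).choose 4 = (j - 2).choose 5 := by
  have h := Nat.sum_Icc_choose (j - 3) 4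
  rw [show j - 3 + 1 = j - 2 by omega] at h
  rw [← h]
  refine Finset.sum_nbij' (fun p => j - p - 2) (fun m => j - m - 2) ?_ ?_ ?_ ?_ fun _ _ => rfl <;>
    intro p hp <;> simp only [Finset.mem_Icc] at hp ⊢ <;> omega

end RCLattice

theorem mainTheorem8 (j : ℕ) (hj : 7 ≤ j) :
    RCLattice.numNonisomorphic (RCLattice.blockClassB3 j)
      = ∑ p ∈ Finset.Icc 1 (j - 6), Nat.choose (j - p - 2) 4 := by
  rw [RCLattice.numNonisomorphic_blockClassB3 hj, RCLattice.sum_choose_four hj]
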